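/- Let $\mathcal{K}$ be a complex Hilbert space (inner products are linear in the second entry) with conjugate Hilbert space $\overline{\mathcal{K}}$ and canonical antilinear bijection $j:\mathcal{K}\to\overline{\mathcal{K}}$, $\langle j(f),j(h)\rangle=\langle h,f\rangle$; tensor products of Hilbert spaces are completed. Let $\mathcal{H}_+=\bigoplus_{n\ge 0}\mathcal{H}_+^{(n)}$, $\mathcal{H}_+^{(n)}=\mathcal{K}^{\otimes_s n}$, be the symmetric Fock space over $\mathcal{K}$, let $\mathcal{F}_+\subset\mathcal{H}_+$ be the subspace of finite particle vectors, and put $\mathcal{L}^{(n)}=\bigoplus_{m\le n}\mathcal{H}_+^{(m)}$. On $\mathcal{F}_+$ let $a_+^*(f)\psi=\sqrt{n+1}\,P_+(f\otimes\psi)$ for $\psi\in\mathcal{H}_+^{(n)}$, where $P_+$ is the projection given by symmetrisation, and let $a_+(f)$ be the restriction to symmetric vectors of $a(f)(v_1\otimes\cdots\otimes v_n)=\sqrt{n}\,\langle f,v_1\rangle\, v_2\otimes\cdots\otimes v_n$ ($a_+(f)=0$ on $\mathcal{H}_+^{(0)}$). For $F\in\mathcal{K}^{\otimes q}\otimes\overline{\mathcal{K}}^{\otimes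 (p-q)}$, $0\le q\le p\le 2$, let $A_{p,q}(F)$ be the smeared normal ordered product: for each $\psi\in\mathcal{F}_+$, $F\mapsto A_{p,q}(F)\psi$ is the unique continuous linear map that sends $f_1\otimes\cdots\otimes f_q\otimes j(h_1)\otimes\cdots\otimes j(h_{p-q})$ to $a_+^*(f_1)\cdots a_+^*(f_q)\,a_+(h_1)\cdots a_+(h_{p-q})\psi$ (for $p=0$ it is multiplication by the number $F\in\mathbb{C}$). Let $O=\sum_{0\le q\le p\le 2}A_{p,q}(F_{p,q})$ with arbitrary $F_{p,q}\in\mathcal{K}^{\otimes q}\otimes\overline{\mathcal{K}}^{\otimes (p-q)}$, as an operator in $\mathcal{H}_+$ with domain $\mathcal{F}_+$. A vector $v$ is called analytic for an operator $T$ with domain $\mathcal{D}$ if there is $c>0$ such that $T^nv\in\mathcal{D}$ and $\|T^nv\|\le c^{n+1}n!$ for all $n\ge 0$. Then: 1. $O\mathcal{F}_+\subset\mathcal{F}_+$, and every $v\in\mathcal{F}_+$ is an analytic vector for $O$. 2. Let $T=O|_{\mathcal{D}}$ be the restriction of $O$ to a subspace $\mathcal{D}\subset\mathcal{F}_+$ that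 is dense in $\mathcal{H}_+$. If $T\mathcal{D}\subset\mathcal{D}$, then every $v\in\mathcal{D}$ is an analytic vector for $T$. 3. Let $T=O|_{\mathcal{D}}$ be as in 2, and suppose that $T\mathcal{D}\subset\mathcal{D}$ or that $\mathcal{D}\cap\mathcal{L}^{(n)}$ is dense in $\mathcal{L}^{(n)}$ for every $n$. If $T$ is symmetric, then $T$ is essentially self-adjoint on $\mathcal{D}$. (In particular, if $O$ is symmetric, then it is essentially self-adjoint on $\mathcal{F}_+$.) -/

import Mathlib

noncomputable section
open scoped TensorProduct ComplexConjugate DirectSum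

namespace BosonFock
universe u

local notation "⟪" x ", " y "⟫" => @inner ℂ _ InnerProductSpace.toInner x y

/-! ### The conjugate Hilbert space -/

/-- The conjugate space `K̄` of `K`: the same additive group and norm, with conjugated scalars and
inner product. -/
def Conj (K : Type u) : Type u := K

namespace Conj
variable (K : Type u) [NormedAddCommGroup K] [InnerProductSpace ℂ K]

instance : NormedAddCommGroup (Conj K) := inferInstanceAs (NormedAddCommGroup K)

/-- Scalars act on the conjugate space through complex conjugation. -/
instance : Module ℂ (Conj K) := Module.compHom K (starRingEnd ℂ)

/-- The antilinear bijection `j` from `K` onto its conjugate space. -/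
def j : K ≃ₛₗ[starRingEnd ℂ] Conj K where
  toFun x := x
  invFun x := x
  map_add' _ _ := rfl
  map_smul' c x := by
    change c • x = (starRingEnd ℂ (starRingEnd ℂ c)) • x
    simp
  left_inv _ := rfl
  right_inv _ := rfl

variable {K}

/-- `⟪j f, j h⟫ = ⟪h, f⟫`. -/
instance : InnerProductSpace ℂ (Conj K) where
  norm_smul_le c x := by
    change ‖(starRingEnd ℂ c) • (show K from x)‖ ≤ ‖c‖ * ‖(show K from x)‖
    rw [norm_smul, RCLike.norm_conj]
  inner x y := inner ℂ ((j K).symm y) ((j K).symm x)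
  norm_sq_eq_re_inner x := norm_sq_eq_re_inner (𝕜 := ℂ) (E := K) x
  conj_inner_symm x y := inner_conj_symm _ _
  add_left x y z := by rw [map_add, inner_add_right]
  smul_left x y c := by
    rw [LinearEquiv.map_smulₛₗ, inner_smul_right]

theorem inner_j (f h : K) : inner ℂ (j K f) (j K h) = inner ℂ h f := rfl
theorem norm_j (f : K) : ‖j K f‖ = ‖f‖ := rfl

instance [CompleteSpace K] : CompleteSpace (Conj K) := inferInstanceAs (CompleteSpace K)

end Conj

/-! ### Hilbert tensor products and tensor powers -/

section Tensor

/-- The Hilbert space tensor product. -/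
abbrev HTensor (E F : Type u) [NormedAddCommGroup E] [InnerProductSpace ℂ E]
    [NormedAddCommGroup F] [InnerProductSpace ℂ F] : Type u :=
  UniformSpace.Completion (E ⊗[ℂ] F)

/-- The elementary tensor `x ⊗ y` as a continuous bilinear map. -/
def htmul (E F : Type u) [NormedAddCommGroup E] [InnerProductSpace ℂ E]
    [NormedAddCommGroup F] [InnerProductSpace ℂ F] : E →L[ℂ] F →L[ℂ] HTensor E F :=
  (ContinuousLinearMap.compL ℂ F (E ⊗[ℂ] F) (HTensor E F)
    (UniformSpace.Completion.toComplL)) ∘L TensorProduct.mkL ℂ E F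

/-- A bundled complex Hilbert space, used for the recursive definition of tensor powers. -/
structure HilbertType : Type (u + 1) where
  carrier : Type u
  [normed : NormedAddCommGroup carrier]
  [innerProd : InnerProductSpace ℂ carrier]
  [complete : CompleteSpace carrier]

attribute [instance] HilbertType.normed HilbertType.innerProd HilbertType.complete

variable (K : Type u) [NormedAddCommGroup K] [InnerProductSpace ℂ K]

/-- The tensor powers `K^{⊗0} = ℂ` (lifted to the universe of `K`),
`K^{⊗(n+1)} = K ⊗ K^{⊗n}`. -/
def tensorPower : ℕ → HilbertType.{u}
  | 0 => ⟨EuclideanSpace ℂ PUnit.{u + 1}⟩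
  | n + 1 => ⟨HTensor K (tensorPower n).carrier⟩

/-- The Hilbert space `H⁽ⁿ⁾ = K^{⊗n}`. -/
def TPow (n : ℕ) : Type u := (tensorPower K n).carrier

instance (n : ℕ) : NormedAddCommGroup (TPow K n) := (tensorPower K n).normed
instance (n : ℕ) : InnerProductSpace ℂ (TPow K n) := (tensorPower K n).innerProd
instance (n : ℕ) : CompleteSpace (TPow K n) := (tensorPower K n).complete

/-- The vector `1 ∈ K^{⊗0} = ℂ`. -/
def vac : TPow K 0 := (EuclideanSpace.single PUnit.unit 1 : EuclideanSpace ℂ PUnit.{u + 1})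

/-- `f ⊗ ψ` for `f ∈ K` and `ψ ∈ K^{⊗n}`. -/
def prepend (n : ℕ) : K →L[ℂ] TPow K n →L[ℂ] TPow K (n + 1) := htmul K (TPow K n)

variable {K}

theorem inner_htmul {E F : Type u} [NormedAddCommGroup E] [InnerProductSpace ℂ E]
    [NormedAddCommGroup F] [InnerProductSpace ℂ F] (a c : E) (b d : F) :
    ⟪htmul E F a b, htmul E F c d⟫ = ⟪a, c⟫ * ⟪b, d⟫ := by
  simp [htmul, UniformSpace.Completion.inner_coe]

theorem inner_prepend {n : ℕ} (f g : K) (x y : TPow K n) :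
    ⟪prepend K n f x, prepend K n g y⟫ = ⟪f, g⟫ * ⟪x, y⟫ :=
  inner_htmul f g x y

/-- `v₁ ⊗ ⋯ ⊗ vₙ`. -/
def simpleTensor : (n : ℕ) → (Fin n → K) → TPow K n
  | 0, _ => vac K
  | n + 1, v => prepend K n (v 0) (simpleTensor n (Fin.tail v))

theorem inner_simpleTensor (n : ℕ) (v w : Fin n → K) :
    ⟪simpleTensor n v, simpleTensor n w⟫ = ∏ i, ⟪v i, w i⟫ := by
  induction n with
  | zero =>
    change ⟪(EuclideanSpace.single PUnit.unit 1 : EuclideanSpace ℂ PUnit.{u + 1}), EuclideanSpace.single PUnit.unit 1⟫ = _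
    simp
  | succ n ih =>
    rw [simpleTensor, simpleTensor, inner_prepend, ih, Fin.prod_univ_succ]; rfl


end Tensor

/-! ### Symmetrisation -/

variable {K : Type u} [NormedAddCommGroup K] [InnerProductSpace ℂ K]

section
open Equiv

/-- The symmetrised tensor `(1/n!) ∑_π v_{π(1)} ⊗ ⋯ ⊗ v_{π(n)}`. -/
def symTensor (n : ℕ) (v : Fin n → K) : TPow K n :=
  ((n.factorial : ℂ))⁻¹ • ∑ π : Perm (Fin n), simpleTensor n (v ∘ π)

variable (K) in
/-- The symmetric tensor power `H₊⁽ⁿ⁾`, the closed span of the symmetrised tensors. -/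
def symPower (n : ℕ) : Submodule ℂ (TPow K n) :=
  (Submodule.span ℂ (Set.range (symTensor (K := K) n))).topologicalClosure

instance (n : ℕ) : CompleteSpace (symPower K n) :=
  (Submodule.isClosed_topologicalClosure _).completeSpace_coe

theorem symTensor_mem (n : ℕ) (v : Fin n → K) : symTensor n v ∈ symPower K n :=
  Submodule.le_topologicalClosure _ (Submodule.subset_span ⟨v, rfl⟩)

variable (K) in
/-- The projection `P_{+,n}` onto `H₊⁽ⁿ⁾`; see `symProj_simpleTensor` for its values. -/
def symProj (n : ℕ) : TPow K n →L[ℂ] symPower K n := (symPower K n).orthogonalProjectionOnto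

theorem inner_symTensor_simpleTensor (n : ℕ) (v w : Fin n → K) :
    ⟪symTensor n w, simpleTensor n v⟫ = ⟪symTensor n w, symTensor n v⟫ := by
  have key : ∀ π : Perm (Fin n), ⟪symTensor n w, simpleTensor n (v ∘ π)⟫
      = ⟪symTensor n w, simpleTensor n v⟫ := by
    intro π
    simp only [symTensor, inner_smul_left, sum_inner, inner_simpleTensor]
    congr 1
    refine Fintype.sum_equiv (Equiv.mulRight π⁻¹) _ _ fun σ => ?_
    refine Fintype.prod_equiv π _ _ fun i => ?_
    simp
  have hv : symTensor n v = ((n.factorial : ℂ))⁻¹ • ∑ π : Perm (Fin n), simpleTensor n (v ∘ π) := rfl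
  rw [hv, inner_smul_right, inner_sum, Finset.sum_congr rfl fun π _ => key π]
  rw [Finset.sum_const, Finset.card_univ, Fintype.card_perm, Fintype.card_fin, nsmul_eq_mul,
    ← mul_assoc, inv_mul_cancel₀ (by exact_mod_cast n.factorial_ne_zero), one_mul]

/-- `P_{+,n} (v₁ ⊗ ⋯ ⊗ vₙ) = (1/n!) ∑_π v_{π(1)} ⊗ ⋯ ⊗ v_{π(n)}`. -/
theorem symProj_simpleTensor (n : ℕ) (v : Fin n → K) :
    (symProj K n (simpleTensor n v) : TPow K n) = symTensor n v := by
  refine (Submodule.eq_starProjection_of_mem_of_inner_eq_zero (symTensor_mem n v) ?_)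
  intro x hx
  have hcl : IsClosed {x : TPow K n | ⟪simpleTensor n v - symTensor n v, x⟫ = 0} :=
    isClosed_eq (by fun_prop) continuous_const
  refine closure_minimal ?_ hcl hx
  intro y hy
  refine Submodule.span_induction ?_ (by simp) ?_ ?_ hy
  · rintro _ ⟨w, rfl⟩
    change ⟪_, _⟫ = (0 : ℂ)
    rw [← inner_conj_symm, inner_sub_right, inner_symTensor_simpleTensor, sub_self, map_zero]
  · intro a b _ _ ha hb
    change ⟪_, _⟫ = (0 : ℂ)
    rw [inner_add_right, show ⟪_, a⟫ = (0 : ℂ) from ha, show ⟪_, b⟫ = (0 : ℂ) from hb,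
      add_zero]
  · intro c a _ ha
    change ⟪_, _⟫ = (0 : ℂ)
    rw [inner_smul_right, show ⟪_, a⟫ = (0 : ℂ) from ha, mul_zero]

/-! ### Creation and annihilation, level-wise -/

/-- The unsymmetrised annihilation operator `a(f)` from `K^{⊗(n+1)}` to `K^{⊗n}`; see
`annFull_simpleTensor` for its values. -/
def annFull (n : ℕ) (f : K) : TPow K (n + 1) →L[ℂ] TPow K n :=
  (Real.sqrt (n + 1) : ℂ) • ContinuousLinearMap.adjoint (prepend K n f)

theorem adjoint_prepend (n : ℕ) (f g : K) (x : TPow K n) :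
    ContinuousLinearMap.adjoint (prepend K n f) (prepend K n g x) = ⟪f, g⟫ • x := by
  refine ext_inner_left ℂ fun y => ?_
  rw [ContinuousLinearMap.adjoint_inner_right, inner_prepend, inner_smul_right]

theorem annFull_simpleTensor (n : ℕ) (f : K) (v : Fin (n + 1) → K) :
    annFull n f (simpleTensor (n + 1) v) =
      (Real.sqrt (n + 1) : ℂ) • ⟪f, v 0⟫ • simpleTensor n (Fin.tail v) := by
  rw [annFull, smul_apply, simpleTensor, adjoint_prepend]

theorem annFull_mem (n : ℕ) (f : K) {x : TPow K (n + 1)} (hx : x ∈ symPower K (n + 1)) :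
    annFull n f x ∈ symPower K n := by
  have hcl : IsClosed ((symPower K n).comap (annFull n f).toLinearMap : Set (TPow K (n + 1))) :=
    (Submodule.isClosed_topologicalClosure _).preimage (annFull n f).continuous
  refine closure_minimal (Submodule.span_le.2 ?_) hcl hx
  rintro _ ⟨v, rfl⟩
  change annFull n f (symTensor (n + 1) v) ∈ symPower K n
  rw [symTensor, map_smul, map_sum]
  refine Submodule.smul_mem _ _ ?_
  rw [← (Perm.decomposeFin (n := n)).symm.sum_comp, Fintype.sum_prod_type]
  refine Submodule.sum_mem _ fun p _ => ?_
  have h : ∀ e : Perm (Fin n), annFull n f (simpleTensor (n + 1) (v ∘ Perm.decomposeFin.symm (p, e)))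
      = ((Real.sqrt (n + 1) : ℂ) * ⟪f, v p⟫) •
        simpleTensor n ((fun i => v (swap 0 p i.succ)) ∘ e) := by
    intro e
    rw [annFull_simpleTensor, smul_smul]
    congr 2
    · simp
    · ext i; simp [Fin.tail]
  rw [Finset.sum_congr rfl fun e _ => h e, ← Finset.smul_sum]
  refine Submodule.smul_mem _ _ ?_
  have := Submodule.smul_mem (symPower K n) (n.factorial : ℂ)
    (symTensor_mem n (fun i => v (swap 0 p i.succ)))
  rwa [symTensor, smul_smul, mul_inv_cancel₀ (by exact_mod_cast n.factorial_ne_zero),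
    one_smul] at this

variable (K) in
/-- `a₊*(f) : H₊⁽ⁿ⁾ → H₊⁽ⁿ⁺¹⁾`, `ψ ↦ √(n+1) P₊ (f ⊗ ψ)`. -/
def creLevel (n : ℕ) : K →ₗ[ℂ] symPower K n →L[ℂ] symPower K (n + 1) where
  toFun f := (Real.sqrt (n + 1) : ℂ) •
    (symProj K (n + 1) ∘L prepend K n f ∘L (symPower K n).subtypeL)
  map_add' f g := by ext; simp
  map_smul' c f := by ext; simp [smul_comm _ c]

variable (K) in
/-- `a₊(f) : H₊⁽ⁿ⁺¹⁾ → H₊⁽ⁿ⁾`, the restriction of `a(f)`, as a linear function of `j f ∈ K̄`. -/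
def annLevel (n : ℕ) : Conj K →ₗ[ℂ] symPower K (n + 1) →L[ℂ] symPower K n where
  toFun f := ((annFull n ((Conj.j K).symm f)) ∘L (symPower K (n + 1)).subtypeL).codRestrict
    (symPower K n) fun x => annFull_mem n _ x.2
  map_add' f g := by ext; simp [annFull]
  map_smul' c f := by
    ext x
    have h : (Conj.j K).symm (c • f) = (starRingEnd ℂ c) • (Conj.j K).symm f :=
      LinearEquiv.map_smulₛₗ _ _ _
    simp [annFull, h, LinearIsometryEquiv.map_smulₛₗ, smul_comm _ c]

theorem annLevel_adjoint (n : ℕ) (g : Conj K) (x : symPower K n) (y : symPower K (n + 1)) :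
    ⟪x, annLevel K n g y⟫ = ⟪creLevel K n ((Conj.j K).symm g) x, y⟫ := by
  obtain ⟨f, rfl⟩ := (Conj.j K).surjective g
  rw [LinearEquiv.symm_apply_apply]
  have hP : ∀ z : TPow K (n + 1), ⟪((symProj K (n + 1) z : symPower K (n + 1)) : TPow K (n + 1)),
      (y : TPow K (n + 1))⟫ = ⟪z, (y : TPow K (n + 1))⟫ := fun z => by
    rw [← Submodule.coe_inner]
    exact Submodule.inner_orthogonalProjectionOnto_eq_of_mem_right y z
  rw [Submodule.coe_inner, Submodule.coe_inner]
  change ⟪(x : TPow K n), (Real.sqrt (n + 1) : ℂ) •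
      ContinuousLinearMap.adjoint (prepend K n f) (y : TPow K (n + 1))⟫ =
    ⟪(Real.sqrt (n + 1) : ℂ) • ((symProj K (n + 1) (prepend K n f x) : symPower K (n + 1)) :
      TPow K (n + 1)), (y : TPow K (n + 1))⟫
  rw [inner_smul_right, inner_smul_left, hP, ContinuousLinearMap.adjoint_inner_right,
    Complex.conj_ofReal]

end

/-! ### Fock space -/

variable (K) in
/-- The symmetric Fock space `H₊ = ⨁ₙ H₊⁽ⁿ⁾` (Hilbert space direct sum). -/
abbrev Fock : Type u := lp (fun n => symPower K n) 2

variable (K) in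
/-- The algebraic direct sum of the `H₊⁽ⁿ⁾`, identified with `finiteParticle` by `toFock`. -/
abbrev FinFock : Type u := ⨁ n, symPower K n

variable (K) in
/-- The inclusion of the algebraic direct sum into Fock space. -/
def toFock : FinFock K →ₗ[ℂ] Fock K :=
  DirectSum.toModule ℂ ℕ (Fock K) fun n => lp.lsingle (E := fun n => symPower K n) 2 n

theorem toFock_apply (ψ : FinFock K) (n : ℕ) : toFock K ψ n = ψ n := by
  induction ψ using DirectSum.induction_on with
  | zero => simp
  | of i x =>
    have : toFock K (DirectSum.of (fun n => symPower K n) i x) = lp.single 2 i x :=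
      DirectSum.toModule_lof ℂ (M := fun n => symPower K n) i x
    rw [this, lp.single_apply]
    by_cases h : n = i
    · subst h; simp
    · rw [Pi.single_eq_of_ne h, DirectSum.of_eq_of_ne _ _ _ h]
  | add x y hx hy => rw [map_add, lp.coeFn_add, Pi.add_apply, hx, hy, DirectSum.add_apply]

theorem toFock_injective : Function.Injective (toFock K) := fun ψ φ h =>
  DFinsupp.ext fun n => by rw [← toFock_apply, ← toFock_apply, h]

variable (K) in
/-- The space `F₊` of finite particle vectors; see `mem_finiteParticle`. -/
def finiteParticle : Submodule ℂ (Fock K) := LinearMap.range (toFock K)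

theorem mem_finiteParticle (ψ : Fock K) : ψ ∈ finiteParticle K ↔ {n | ψ n ≠ 0}.Finite := by
  classical
  constructor
  · rintro ⟨φ, rfl⟩
    refine (DFinsupp.support φ).finite_toSet.subset fun n hn => ?_
    rw [Set.mem_ofPred_eq, toFock_apply] at hn
    simpa using hn
  · intro h
    refine ⟨DFinsupp.mk h.toFinset fun n => ψ n, ?_⟩
    ext1; funext n
    rw [toFock_apply, DFinsupp.mk_apply]
    split_ifs with hn
    · rfl
    · have h0 : ψ n = 0 := by
        by_contra h'
        exact hn (by simpa using h')
      exact h0.symm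

variable (K) in
/-- The creation operators `a₊*(f)` on finite particle vectors. -/
def cre : K →ₗ[ℂ] Module.End ℂ (FinFock K) where
  toFun f := DirectSum.toModule ℂ ℕ (FinFock K) fun n =>
    DirectSum.lof ℂ ℕ (fun n => symPower K n) (n + 1) ∘ₗ (creLevel K n f).toLinearMap
  map_add' f g := by ext; simp
  map_smul' c f := by ext; simp

variable (K) in
/-- The annihilation operators `a₊(f)` on finite particle vectors, as a linear function of
`j f ∈ K̄`; they vanish on `H₊⁽⁰⁾`. -/
def ann : Conj K →ₗ[ℂ] Module.End ℂ (FinFock K) where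
  toFun f := DirectSum.toModule ℂ ℕ (FinFock K) fun
    | 0 => 0
    | n + 1 => DirectSum.lof ℂ ℕ (fun n => symPower K n) n ∘ₗ (annLevel K n f).toLinearMap
  map_add' f g := by ext (_ | n) <;> simp
  map_smul' c f := by ext (_ | n) <;> simp

/-! ### Smearing -/

theorem norm_toFock_lof (n : ℕ) (x : symPower K n) :
    ‖toFock K (DirectSum.lof ℂ ℕ (fun n => symPower K n) n x)‖ = ‖x‖ := by
  rw [toFock, DirectSum.toModule_lof]
  exact lp.norm_single (E := fun n => symPower K n) (by norm_num) n x

theorem cre_lof (f : K) (n : ℕ) (x : symPower K n) :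
    cre K f (DirectSum.lof ℂ ℕ (fun n => symPower K n) n x) =
      DirectSum.lof ℂ ℕ (fun n => symPower K n) (n + 1) (creLevel K n f x) :=
  DirectSum.toModule_lof ℂ (M := fun n => symPower K n) n x

theorem ann_lof_zero (f : Conj K) (x : symPower K 0) :
    ann K f (DirectSum.lof ℂ ℕ (fun n => symPower K n) 0 x) = 0 :=
  DirectSum.toModule_lof ℂ (M := fun n => symPower K n) 0 x

theorem ann_lof_succ (f : Conj K) (n : ℕ) (x : symPower K (n + 1)) :
    ann K f (DirectSum.lof ℂ ℕ (fun n => symPower K n) (n + 1) x) =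
      DirectSum.lof ℂ ℕ (fun n => symPower K n) n (annLevel K n f x) :=
  DirectSum.toModule_lof ℂ (M := fun n => symPower K n) (n + 1) x

section Smear
variable {E₁ E₂ : Type u} [NormedAddCommGroup E₁] [InnerProductSpace ℂ E₁]
  [NormedAddCommGroup E₂] [InnerProductSpace ℂ E₂]

/-- For fixed `ψ`, the linear map with `x ⊗ y ↦ A(x) B(y) ψ` on the algebraic tensor product. -/
def algSmear (A : E₁ →ₗ[ℂ] Module.End ℂ (FinFock K)) (B : E₂ →ₗ[ℂ] Module.End ℂ (FinFock K))
    (ψ : FinFock K) : E₁ ⊗[ℂ] E₂ →ₗ[ℂ] Fock K :=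
  toFock K ∘ₗ LinearMap.applyₗ ψ ∘ₗ
    TensorProduct.lift ((LinearMap.mul ℂ (Module.End ℂ (FinFock K))).compl₁₂ A B)

theorem algSmear_tmul (A : E₁ →ₗ[ℂ] Module.End ℂ (FinFock K))
    (B : E₂ →ₗ[ℂ] Module.End ℂ (FinFock K)) (ψ : FinFock K) (x : E₁) (y : E₂) :
    algSmear A B ψ (x ⊗ₜ y) = toFock K (A x (B y ψ)) := rfl

theorem algSmear_add (A : E₁ →ₗ[ℂ] Module.End ℂ (FinFock K))
    (B : E₂ →ₗ[ℂ] Module.End ℂ (FinFock K)) (ψ φ : FinFock K) :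
    algSmear A B (ψ + φ) = algSmear A B ψ + algSmear A B φ := by
  ext1; ext; simp [algSmear]

theorem algSmear_smul (A : E₁ →ₗ[ℂ] Module.End ℂ (FinFock K))
    (B : E₂ →ₗ[ℂ] Module.End ℂ (FinFock K)) (c : ℂ) (ψ : FinFock K) :
    algSmear A B (c • ψ) = c • algSmear A B ψ := by
  ext1; ext; simp [algSmear]

/-- For each `ψ` the map `x ⊗ y ↦ A(x) B(y) ψ` is bounded for the Hilbert tensor norm. -/
def Smearable (A : E₁ →ₗ[ℂ] Module.End ℂ (FinFock K))
    (B : E₂ →ₗ[ℂ] Module.End ℂ (FinFock K)) : Prop :=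
  ∀ ψ, ∃ C, ∀ x : E₁ ⊗[ℂ] E₂, ‖algSmear A B ψ x‖ ≤ C * ‖x‖

theorem Smearable.of_lof {A : E₁ →ₗ[ℂ] Module.End ℂ (FinFock K)}
    {B : E₂ →ₗ[ℂ] Module.End ℂ (FinFock K)}
    (h : ∀ n y, ∃ C, ∀ x : E₁ ⊗[ℂ] E₂,
      ‖algSmear A B (DirectSum.lof ℂ ℕ (fun n => symPower K n) n y) x‖ ≤ C * ‖x‖) :
    Smearable A B := by
  intro ψ
  induction ψ using DirectSum.induction_on with
  | zero =>
    refine ⟨0, fun x => ?_⟩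
    have : algSmear A B (0 : FinFock K) = 0 := by simpa using algSmear_smul A B 0 0
    simp [this]
  | of i x => exact h i x
  | add a b ha hb =>
    obtain ⟨C, hC⟩ := ha
    obtain ⟨D, hD⟩ := hb
    refine ⟨C + D, fun x => ?_⟩
    rw [algSmear_add, LinearMap.add_apply, add_mul]
    exact (norm_add_le _ _).trans (add_le_add (hC x) (hD x))

theorem denseRange_toCompl : DenseRange
    (UniformSpace.Completion.toComplₗᵢ (𝕜 := ℂ) (E := E₁ ⊗[ℂ] E₂)).toLinearMap :=
  UniformSpace.Completion.denseRange_coe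

theorem Smearable.extend_unique {A : E₁ →ₗ[ℂ] Module.End ℂ (FinFock K)}
    {B : E₂ →ₗ[ℂ] Module.End ℂ (FinFock K)} (h : Smearable A B) (ψ : FinFock K)
    (g : HTensor E₁ E₂ →L[ℂ] Fock K) (hg : ∀ x : E₁ ⊗[ℂ] E₂, g x = algSmear A B ψ x) :
    (algSmear A B ψ).extendOfNorm
      (UniformSpace.Completion.toComplₗᵢ (𝕜 := ℂ) (E := E₁ ⊗[ℂ] E₂)).toLinearMap = g := by
  obtain ⟨C, hC⟩ := h ψ
  refine LinearMap.extendOfNorm_unique denseRange_toCompl C (fun x => ?_) g (LinearMap.ext hg)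
  simpa using hC x

theorem Smearable.extend_coe {A : E₁ →ₗ[ℂ] Module.End ℂ (FinFock K)}
    {B : E₂ →ₗ[ℂ] Module.End ℂ (FinFock K)} (h : Smearable A B) (ψ : FinFock K)
    (x : E₁ ⊗[ℂ] E₂) :
    (algSmear A B ψ).extendOfNorm
      (UniformSpace.Completion.toComplₗᵢ (𝕜 := ℂ) (E := E₁ ⊗[ℂ] E₂)).toLinearMap
        (x : HTensor E₁ E₂) = algSmear A B ψ x := by
  obtain ⟨C, hC⟩ := h ψ
  exact LinearMap.extendOfNorm_eq denseRange_toCompl ⟨C, fun x => by simpa using hC x⟩ x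

/-- The operator `(A B)(F)` for `F` in the Hilbert tensor product: for each `ψ`, the map
`F ↦ (A B)(F) ψ` is the unique continuous linear extension of `x ⊗ y ↦ A(x) B(y) ψ`. -/
def smear (A : E₁ →ₗ[ℂ] Module.End ℂ (FinFock K)) (B : E₂ →ₗ[ℂ] Module.End ℂ (FinFock K))
    (h : Smearable A B) (F : HTensor E₁ E₂) : FinFock K →ₗ[ℂ] Fock K where
  toFun ψ := (algSmear A B ψ).extendOfNorm
      (UniformSpace.Completion.toComplₗᵢ (𝕜 := ℂ) (E := E₁ ⊗[ℂ] E₂)).toLinearMap F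
  map_add' ψ φ := by
    rw [h.extend_unique (ψ + φ) (_ + _) fun x => ?_, add_apply]
    rw [add_apply, h.extend_coe, h.extend_coe, algSmear_add, LinearMap.add_apply]
  map_smul' c ψ := by
    rw [h.extend_unique (c • ψ) (c • _) fun x => ?_, smul_apply]
    · rfl
    rw [smul_apply, h.extend_coe, algSmear_smul, LinearMap.smul_apply]

theorem smear_tmul (A : E₁ →ₗ[ℂ] Module.End ℂ (FinFock K))
    (B : E₂ →ₗ[ℂ] Module.End ℂ (FinFock K)) (h : Smearable A B) (x : E₁) (y : E₂)
    (ψ : FinFock K) : smear A B h (htmul E₁ E₂ x y) ψ = toFock K (A x (B y ψ)) :=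
  h.extend_coe ψ (x ⊗ₜ y)

theorem continuous_smear (A : E₁ →ₗ[ℂ] Module.End ℂ (FinFock K))
    (B : E₂ →ₗ[ℂ] Module.End ℂ (FinFock K)) (h : Smearable A B) (ψ : FinFock K) :
    Continuous fun F => smear A B h F ψ :=
  ContinuousLinearMap.continuous _

end Smear

/-! ### Existence of the smeared operators -/

theorem norm_htmul {E F : Type u} [NormedAddCommGroup E] [InnerProductSpace ℂ E]
    [NormedAddCommGroup F] [InnerProductSpace ℂ F] (a : E) (b : F) :
    ‖htmul E F a b‖ = ‖a‖ * ‖b‖ :=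
  (UniformSpace.Completion.norm_coe _).trans (TensorProduct.norm_tmul a b)

theorem exists_creLift {E : Type u} [NormedAddCommGroup E] [InnerProductSpace ℂ E] (n : ℕ)
    (b : E →L[ℂ] symPower K n) :
    ∃ T : K ⊗[ℂ] E →L[ℂ] symPower K (n + 1), (∀ x e, T (x ⊗ₜ e) = creLevel K n x (b e)) ∧
      ∀ z, ‖T z‖ ≤ Real.sqrt (n + 1) * ‖b‖ * ‖z‖ := by
  let S : K ⊗[ℂ] E →L[ℂ] K ⊗[ℂ] TPow K n :=
    ((symPower K n).subtypeL ∘L b).lTensor K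
  let ι : K ⊗[ℂ] TPow K n →L[ℂ] TPow K (n + 1) :=
    (UniformSpace.Completion.toComplL : K ⊗[ℂ] TPow K n →L[ℂ] HTensor K (TPow K n))
  refine ⟨(Real.sqrt (n + 1) : ℂ) • (symProj K (n + 1) ∘L ι ∘L S), fun x e => rfl, fun z => ?_⟩
  have h1 : ‖symProj K (n + 1) (ι (S z))‖ ≤ ‖ι (S z)‖ :=
    Submodule.norm_orthogonalProjectionOnto_apply_le _ _
  have h2 : ‖ι (S z)‖ = ‖S z‖ := UniformSpace.Completion.norm_coe _
  have h3 : ‖S z‖ ≤ ‖b‖ * ‖z‖ := by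
    refine (ContinuousLinearMap.le_opNorm _ _).trans ?_
    gcongr
    refine (ContinuousLinearMap.norm_lTensor_le _ _).trans ?_
    refine ContinuousLinearMap.opNorm_le_bound _ (norm_nonneg b) fun x => ?_
    exact b.le_opNorm x
  change ‖(Real.sqrt (n + 1) : ℂ) • symProj K (n + 1) (ι (S z))‖ ≤ _
  rw [norm_smul, Complex.norm_real, Real.norm_of_nonneg (Real.sqrt_nonneg _), mul_assoc]
  gcongr
  linarith

theorem norm_creLevel_le (n : ℕ) (f : K) (x : symPower K n) :
    ‖creLevel K n f x‖ ≤ Real.sqrt (n + 1) * ‖x‖ * ‖f‖ := by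
  have h1 : ‖symProj K (n + 1) (prepend K n f x)‖ ≤ ‖prepend K n f x‖ :=
    Submodule.norm_orthogonalProjectionOnto_apply_le _ _
  have h2 : ‖prepend K n f x‖ = ‖f‖ * ‖x‖ := norm_htmul _ _
  change ‖(Real.sqrt (n + 1) : ℂ) • symProj K (n + 1) (prepend K n f x)‖ ≤ _
  rw [norm_smul, Complex.norm_real, Real.norm_of_nonneg (Real.sqrt_nonneg _), mul_assoc]
  gcongr
  linarith

theorem norm_annLevel_le (n : ℕ) (f : Conj K) (x : symPower K (n + 1)) :
    ‖annLevel K n f x‖ ≤ Real.sqrt (n + 1) * ‖x‖ * ‖f‖ := by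
  rcases (norm_nonneg (annLevel K n f x)).eq_or_lt with h | h
  · rw [← h]; positivity
  refine le_of_mul_le_mul_right ?_ h
  have h1 : ‖annLevel K n f x‖ * ‖annLevel K n f x‖ =
      ‖⟪annLevel K n f x, annLevel K n f x⟫‖ := by
    rw [inner_self_eq_norm_sq_to_K, norm_pow]; simp [sq]
  have h2 : ⟪annLevel K n f x, annLevel K n f x⟫ = ⟪creLevel K n ((Conj.j K).symm f) (annLevel K n f x), x⟫ :=
    annLevel_adjoint n f _ x
  rw [h1, h2]
  refine (norm_inner_le_norm _ _).trans ?_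
  have h3 : ‖creLevel K n ((Conj.j K).symm f) (annLevel K n f x)‖ ≤
      Real.sqrt (n + 1) * ‖annLevel K n f x‖ * ‖f‖ := norm_creLevel_le n ((Conj.j K).symm f) _
  calc _ ≤ Real.sqrt (n + 1) * ‖annLevel K n f x‖ * ‖f‖ * ‖x‖ := by gcongr
    _ = _ := by ring

theorem smearable_cre_of {E : Type u} [NormedAddCommGroup E] [InnerProductSpace ℂ E]
    (B : E →ₗ[ℂ] Module.End ℂ (FinFock K))
    (h : ∀ n y, (∀ e, B e (DirectSum.lof ℂ ℕ (fun n => symPower K n) n y) = 0) ∨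
      ∃ m, ∃ b : E →L[ℂ] symPower K m, ∀ e, B e (DirectSum.lof ℂ ℕ (fun n => symPower K n) n y) =
        DirectSum.lof ℂ ℕ (fun n => symPower K n) m (b e)) : Smearable (cre K) B := by
  refine Smearable.of_lof fun n y => ?_
  rcases h n y with h | ⟨m, b, hb⟩
  · refine ⟨0, fun x => ?_⟩
    have : algSmear (cre K) B (DirectSum.lof ℂ ℕ (fun n => symPower K n) n y) = 0 :=
      TensorProduct.ext' fun x e => by rw [algSmear_tmul, h]; simp
    simp [this]
  · obtain ⟨T, hT, hb'⟩ := exists_creLift m b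
    refine ⟨_, fun x => le_of_eq_of_le ?_ (hb' x)⟩
    have : algSmear (cre K) B (DirectSum.lof ℂ ℕ (fun n => symPower K n) n y) =
        toFock K ∘ₗ DirectSum.lof ℂ ℕ (fun n => symPower K n) (m + 1) ∘ₗ T.toLinearMap :=
      TensorProduct.ext' fun x e => by
        rw [algSmear_tmul, hb, cre_lof, ← hT]; rfl
    rw [this]
    exact norm_toFock_lof _ _

theorem smearable_cre_cre : Smearable (cre K) (cre K) :=
  smearable_cre_of _ fun n y => Or.inr ⟨n + 1,
    ((LinearMap.applyₗ y ∘ₗ ContinuousLinearMap.coeLM ℂ ∘ₗ creLevel K n).mkContinuous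
      (Real.sqrt (n + 1) * ‖y‖) fun e => norm_creLevel_le n e y), fun e => cre_lof e n y⟩

theorem smearable_cre_ann : Smearable (cre K) (ann K) :=
  smearable_cre_of _ fun
    | 0 => fun y => Or.inl fun e => ann_lof_zero e y
    | n + 1 => fun y => Or.inr ⟨n,
      ((LinearMap.applyₗ y ∘ₗ ContinuousLinearMap.coeLM ℂ ∘ₗ annLevel K n).mkContinuous
        (Real.sqrt (n + 1) * ‖y‖) fun e => norm_annLevel_le n e y), fun e => ann_lof_succ e n y⟩

/-- The antilinear isometry `j f ⊗ j h ↦ h ⊗ f`. -/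
theorem exists_conjSwap : ∃ J : Conj K ⊗[ℂ] Conj K →ₛₗ[starRingEnd ℂ] K ⊗[ℂ] K,
    (∀ f h, J (f ⊗ₜ h) = (Conj.j K).symm h ⊗ₜ (Conj.j K).symm f) ∧ ∀ z, ‖J z‖ = ‖z‖ := by
  let J₀ : Conj K ⊗[ℂ] Conj K →ₛₗ[starRingEnd ℂ] K ⊗[ℂ] K :=
    TensorProduct.map (Conj.j K).symm.toLinearMap (Conj.j K).symm.toLinearMap
  have h0 : ∀ x y, ⟪J₀ x, J₀ y⟫ = ⟪y, x⟫ := fun x y =>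
    x.induction_on (by simp) (fun _ _ =>
      y.induction_on (by simp) (fun _ _ => rfl)
      fun _ _ h1 h2 => by rw [map_add, inner_add_right, inner_add_left, h1, h2])
    fun _ _ h1 h2 => by rw [map_add, inner_add_right, inner_add_left, h1, h2]
  refine ⟨(TensorProduct.comm ℂ K K).toLinearMap.comp J₀, fun f h => rfl, fun z => ?_⟩
  refine (TensorProduct.norm_comm (J₀ z)).trans ?_
  rw [@norm_eq_sqrt_re_inner ℂ, @norm_eq_sqrt_re_inner ℂ, h0]

theorem smearable_ann_ann : Smearable (ann K) (ann K) := by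
  refine Smearable.of_lof fun n y => ?_
  have hz : (∀ f h : Conj K, ann K f (ann K h (DirectSum.lof ℂ ℕ (fun n => symPower K n) n y)) = 0) →
      ∃ C, ∀ x, ‖algSmear (ann K) (ann K)
        (DirectSum.lof ℂ ℕ (fun n => symPower K n) n y) x‖ ≤ C * ‖x‖ := fun h => by
    refine ⟨0, fun x => ?_⟩
    have : algSmear (ann K) (ann K) (DirectSum.lof ℂ ℕ (fun n => symPower K n) n y) = 0 :=
      TensorProduct.ext' fun x e => by rw [algSmear_tmul, h]; simp
    simp [this]
  match n, y, hz with
  | 0, y, hz => exact hz fun f h => by rw [ann_lof_zero, map_zero]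
  | 1, y, hz => exact hz fun f h => by rw [ann_lof_succ, ann_lof_zero]
  | n + 2, y, _ =>
    let g : Conj K ⊗[ℂ] Conj K →ₗ[ℂ] symPower K n :=
      TensorProduct.lift (LinearMap.mk₂ ℂ (fun f h => annLevel K n f (annLevel K (n + 1) h y))
        (by simp) (by simp) (by simp) (by simp))
    have hg : algSmear (ann K) (ann K) (DirectSum.lof ℂ ℕ (fun n => symPower K n) (n + 2) y) =
        toFock K ∘ₗ DirectSum.lof ℂ ℕ (fun n => symPower K n) n ∘ₗ g :=
      TensorProduct.ext' fun f h => by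
        rw [algSmear_tmul, ann_lof_succ, ann_lof_succ]; rfl
    obtain ⟨J, hJ, hJn⟩ := exists_conjSwap (K := K)
    let c : ℝ := Real.sqrt ((n + 1 : ℕ) + 1) * Real.sqrt (n + 1)
    refine ⟨c * ‖y‖, fun z => ?_⟩
    rw [hg]
    refine (norm_toFock_lof _ _).trans_le ?_
    obtain ⟨T, hT, hTn⟩ := exists_creLift (n + 1)
      ((LinearMap.applyₗ (g z) ∘ₗ ContinuousLinearMap.coeLM ℂ ∘ₗ creLevel K n).mkContinuous
        (Real.sqrt (n + 1) * ‖g z‖) fun e => norm_creLevel_le n e (g z))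
    have key : ∀ w, ⟪g z, g w⟫ = ⟪T (J w), y⟫ := fun w => by
      induction w using TensorProduct.induction_on with
      | zero => simp
      | tmul f h =>
        rw [hJ, hT]
        exact (annLevel_adjoint n f _ _).trans (annLevel_adjoint (n + 1) h _ _)
      | add a b ha hb => rw [map_add, map_add, map_add, inner_add_right, inner_add_left, ha, hb]
    rcases (norm_nonneg (g z)).eq_or_lt with h | h
    · rw [← h]; positivity
    refine le_of_mul_le_mul_right ?_ h
    have h1 : ‖g z‖ * ‖g z‖ = ‖⟪g z, g z⟫‖ := by
      rw [inner_self_eq_norm_sq_to_K, norm_pow]; simp [sq]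
    rw [h1, key z]
    refine (norm_inner_le_norm _ _).trans ?_
    have h2 := hTn (J z)
    have h3 : ‖(LinearMap.applyₗ (g z) ∘ₗ ContinuousLinearMap.coeLM ℂ ∘ₗ creLevel K n).mkContinuous
        (Real.sqrt (n + 1) * ‖g z‖) fun e => norm_creLevel_le n e (g z)‖ ≤
        Real.sqrt (n + 1) * ‖g z‖ := LinearMap.mkContinuous_norm_le _ (by positivity) _
    calc ‖T (J z)‖ * ‖y‖
        ≤ (Real.sqrt ((n + 1 : ℕ) + 1) * (Real.sqrt (n + 1) * ‖g z‖) * ‖J z‖) * ‖y‖ := by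
          gcongr
          exact h2.trans (by gcongr)
      _ = c * ‖y‖ * ‖z‖ * ‖g z‖ := by rw [hJn]; ring

/-! ### Polynomials -/

variable (K) in
/-- The normal ordered polynomial of order at most two with coefficients `c ∈ ℂ`, `f ∈ K`,
`g ∈ K̄`, `F ∈ K ⊗ K`, `G ∈ K ⊗ K̄`, `H ∈ K̄ ⊗ K̄`:
`c + a₊*(f) + a₊(g) + (a₊* a₊*)(F) + (a₊* a₊)(G) + (a₊ a₊)(H)`. -/
def wickPolynomial (c : ℂ) (f : K) (g : Conj K) (F : HTensor K K) (G : HTensor K (Conj K))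
    (H : HTensor (Conj K) (Conj K)) : FinFock K →ₗ[ℂ] Fock K :=
  c • toFock K + toFock K ∘ₗ cre K f + toFock K ∘ₗ ann K g +
    smear (cre K) (cre K) smearable_cre_cre F +
    smear (cre K) (ann K) smearable_cre_ann G +
    smear (ann K) (ann K) smearable_ann_ann H

variable (K) in
/-- The normal ordered polynomial as an operator in `H₊` with domain the space of all finite
particle vectors. -/
def wickOperator (c : ℂ) (f : K) (g : Conj K) (F : HTensor K K) (G : HTensor K (Conj K))
    (H : HTensor (Conj K) (Conj K)) : Fock K →ₗ.[ℂ] Fock K where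
  domain := finiteParticle K
  toFun := wickPolynomial K c f g F G H ∘ₗ
    (LinearEquiv.ofInjective (toFock K) toFock_injective).symm.toLinearMap

theorem wickOperator_apply (c : ℂ) (f : K) (g : Conj K) (F : HTensor K K)
    (G : HTensor K (Conj K)) (H : HTensor (Conj K) (Conj K)) (ψ : FinFock K) :
    wickOperator K c f g F G H ⟨toFock K ψ, ψ, rfl⟩ = wickPolynomial K c f g F G H ψ :=
  congrArg (wickPolynomial K c f g F G H)
    ((LinearEquiv.ofInjective (toFock K) toFock_injective).symm_apply_apply ψ)

variable (K) in
/-- The vectors with at most `n` particles, `⨁_{m ≤ n} H₊⁽ᵐ⁾`. -/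
def atMost (n : ℕ) : Submodule ℂ (Fock K) where
  carrier := {ψ | ∀ m, n < m → ψ m = 0}
  zero_mem' := fun _ _ => rfl
  add_mem' := fun {a b} ha hb m hm => by rw [lp.coeFn_add, Pi.add_apply, ha m hm, hb m hm, add_zero]
  smul_mem' := fun c a ha m hm => by rw [lp.coeFn_smul, Pi.smul_apply, ha m hm, smul_zero]

/-! ### Unbounded operators -/

section Operators
variable {X : Type u} [NormedAddCommGroup X] [InnerProductSpace ℂ X]

/-- `v` is an analytic vector for `T`: for some `c > 0`, all powers satisfy `Tⁿ v ∈ D(T)` and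
`‖Tⁿ v‖ ≤ c^(n+1) n!`. The sequence `w` is `w n = Tⁿ v`. -/
def IsAnalyticVector (T : X →ₗ.[ℂ] X) (v : X) : Prop :=
  ∃ c : ℝ, 0 < c ∧ ∃ w : ℕ → T.domain, (w 0 : X) = v ∧ (∀ n, (w (n + 1) : X) = T (w n)) ∧
    ∀ n, ‖(w n : X)‖ ≤ c ^ (n + 1) * (n.factorial : ℝ)

/-- `T` maps its domain into itself. -/
def PreservesDomain (T : X →ₗ.[ℂ] X) : Prop := ∀ x : T.domain, T x ∈ T.domain

/-- `T` is symmetric: it is densely defined and `⟪T x, y⟫ = ⟪x, T y⟫` on its domain. -/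
def IsSymmetricOp (T : X →ₗ.[ℂ] X) : Prop :=
  Dense (T.domain : Set X) ∧ T.IsFormalAdjoint T

/-- `T` is essentially self-adjoint: it is closable and its closure is self-adjoint. -/
def IsEssentiallySelfAdjoint [CompleteSpace X] (T : X →ₗ.[ℂ] X) : Prop :=
  T.IsClosable ∧ IsSelfAdjoint T.closure

end Operators

end BosonFock

end

open BosonFock

/-!
The creation and annihilation parts of the normal ordered polynomial `O` change the particle number
by at most two, and on the `n`-particle vectors they are bounded by a multiple of `n + 2`
(`exists_levelBound_wickPolynomial`); for the smeared products the bounds hold first on algebraic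
tensors and pass to the completed tensor product by density. For a vector `v` with at most `k`
particles, `‖Oⁿ v‖` is therefore dominated by a product of `n` factors `C (k + 2 j + 2)`, so that
`∑ₙ Rⁿ / n! ‖Oⁿ v‖` converges for `R = 1 / (4 C)`, a time which does not depend on `v`
(`exists_summable_exp_of_le_wickOperator`). This shows that the vectors are analytic.

Because the time `R` is common to all vectors of the domain, essential self-adjointness needs neither
the spectral theorem nor a unitary group. If `T` is symmetric with invariant domain, the exponential
series `U v = ∑ₙ (it)ⁿ / n! Tⁿ v`, `|t| = R`, preserves norms (`norm_tsum_exp`). If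
`⟪ψ, T x⟫ = ±i ⟪ψ, x⟫` on the domain, then `⟪ψ, U v⟫ = e^R ⟪ψ, v⟫` for a suitable sign of `t`, whence
`e^R ‖ψ‖ ≤ ‖ψ‖` by density and `ψ = 0` (`hasTrivialDeficiency_of_summable_exp`). Trivial deficiency
spaces make the closure self-adjoint (`HasTrivialDeficiency.isEssentiallySelfAdjoint`).

If instead the domain of `T` is dense in each `atMost K n`, then, `O` being bounded there, the graph of
`O` lies in the closure of the graph of `T` (`graph_wickOperator_subset_closure`). Hence `O` is
symmetric, the preceding argument applies to `O`, whose domain is invariant, and the vanishing of the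
deficiency spaces carries over to `T`.
-/

namespace BosonFock
open Filter Topology
universe u

/-! ### Essential self-adjointness from trivial deficiency spaces -/

section Operators
variable {X : Type*} [NormedAddCommGroup X] [InnerProductSpace ℂ X]

/-- The deficiency spaces of `T` at `±i` vanish: a vector `ψ` with `⟪ψ, T x⟫ = ±i ⟪ψ, x⟫` for all
`x ∈ D(T)` is zero. -/
def HasTrivialDeficiency (T : X →ₗ.[ℂ] X) : Prop :=
  ∀ ψ : X, ∀ s : ℝ, |s| = 1 →
    (∀ x : T.domain, inner ℂ ψ (T x) = Complex.I * s * inner ℂ ψ (x : X)) → ψ = 0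

/-- Symmetry extends from `T` to every operator whose graph lies in the closure of that of `T`. -/
theorem isFormalAdjoint_of_graph_subset_closure {T S : X →ₗ.[ℂ] X} (hT : T.IsFormalAdjoint T)
    (h : ∀ x : S.domain, ((x : X), S x) ∈ closure (T.graph : Set (X × X))) :
    S.IsFormalAdjoint S := by
  intro x y
  have h' := map_mem_closure₂ (u := {(0 : ℂ)})
    (f := fun p q : X × X => inner ℂ p.2 q.1 - inner ℂ p.1 q.2) (by fun_prop) (h x) (h y) (by
      rintro p hp q hq
      obtain ⟨a, ha1, ha2⟩ := T.mem_graph_iff.1 hp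
      obtain ⟨b, hb1, hb2⟩ := T.mem_graph_iff.1 hq
      simpa [← ha1, ← ha2, ← hb1, ← hb2, sub_eq_zero] using hT a b)
  simpa [sub_eq_zero] using h'

theorem HasTrivialDeficiency.of_graph_subset_closure {T S : X →ₗ.[ℂ] X}
    (hS : HasTrivialDeficiency S)
    (h : ∀ x : S.domain, ((x : X), S x) ∈ closure (T.graph : Set (X × X))) :
    HasTrivialDeficiency T := by
  intro ψ s hs hψ
  refine hS ψ s hs fun x => ?_
  have hcl : IsClosed {p : X × X | inner ℂ ψ p.2 = Complex.I * s * inner ℂ ψ p.1} :=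
    isClosed_eq (by fun_prop) (by fun_prop)
  refine closure_minimal (fun p hp => ?_) hcl (h x)
  obtain ⟨a, ha1, ha2⟩ := T.mem_graph_iff.1 hp
  simpa [← ha1, ← ha2] using hψ a

theorem _root_.LinearPMap.IsFormalAdjoint.closure [CompleteSpace X] {T : X →ₗ.[ℂ] X}
    (hT : T.IsFormalAdjoint T) (hc : T.IsClosable) : T.closure.IsFormalAdjoint T.closure := by
  refine isFormalAdjoint_of_graph_subset_closure hT fun x => ?_
  have hx := T.closure.mem_graph x
  rwa [← hc.graph_closure_eq_closure_graph] at hx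

/-- Since `⟪S x, x⟫` is real for symmetric `S`, `‖S x + i x‖² = ‖S x‖² + ‖x‖²`; so `S + i` is bounded
below with respect to the graph norm. -/
theorem norm_prod_le_norm_add_I_smul {S : X →ₗ.[ℂ] X} (hS : S.IsFormalAdjoint S) {p : X × X}
    (hp : p ∈ S.graph) : ‖p‖ ≤ ‖p.2 + Complex.I • p.1‖ := by
  obtain ⟨a, ha1, ha2⟩ := S.mem_graph_iff.1 hp
  have him : (inner ℂ p.2 p.1).im = 0 := by
    rw [← ha1, ← ha2]
    have h := congrArg Complex.im (inner_conj_symm (𝕜 := ℂ) (a : X) (S a))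
    rw [Complex.conj_im, hS a a] at h
    rw [hS a a]
    linarith
  have hsq : ‖p.2 + Complex.I • p.1‖ ^ 2 = ‖p.2‖ ^ 2 + ‖p.1‖ ^ 2 := by
    rw [@norm_add_sq ℂ, inner_smul_right, norm_smul, Complex.norm_I]
    simp [him]
  rw [Prod.norm_def]
  refine max_le ?_ ?_ <;> refine le_of_sq_le_sq ?_ (norm_nonneg _) <;> rw [hsq] <;>
    nlinarith [sq_nonneg ‖p.1‖, sq_nonneg ‖p.2‖]

/-- The range of `S + i`, for `S` the closure of `T`, is closed by `norm_prod_le_norm_add_I_smul` and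
dense because its orthogonal complement is a deficiency space. -/
theorem surjective_closure_add_I_smul [CompleteSpace X] {T : X →ₗ.[ℂ] X}
    (hT : T.IsFormalAdjoint T) (hc : T.IsClosable) (hd : HasTrivialDeficiency T) (z : X) :
    ∃ x : T.closure.domain, T.closure x + Complex.I • (x : X) = z := by
  have hclosed : IsClosed (T.closure.graph : Set (X × X)) := hc.closure_isClosed
  have : CompleteSpace T.closure.graph := hclosed.completeSpace_coe
  let L : T.closure.graph →L[ℂ] X :=
    (ContinuousLinearMap.snd ℂ X X + Complex.I • ContinuousLinearMap.fst ℂ X X) ∘L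
      T.closure.graph.subtypeL
  have hanti : AntilipschitzWith 1 L :=
    L.antilipschitz_of_bound fun p => by
      rw [NNReal.coe_one, one_mul]
      exact norm_prod_le_norm_add_I_smul (hT.closure hc) p.2
  have hrange : IsClosed (LinearMap.range L.toLinearMap : Set X) := by
    rw [LinearMap.coe_range]
    exact hanti.isClosed_range L.uniformContinuous
  have htop : LinearMap.range L.toLinearMap = ⊤ := by
    rw [← hrange.submodule_topologicalClosure_eq, Submodule.topologicalClosure_eq_top_iff,
      Submodule.eq_bot_iff]
    intro ψ hψ
    refine hd ψ (-1) (by simp) fun x => ?_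
    have hx : ((x : X), T x) ∈ T.closure.graph :=
      LinearPMap.le_graph_of_le T.le_closure (T.mem_graph x)
    have h := (Submodule.mem_orthogonal' _ _).1 hψ (L ⟨_, hx⟩) ⟨_, rfl⟩
    have h' : inner ℂ ψ (T x + Complex.I • (x : X)) = 0 := h
    rw [inner_add_right, inner_smul_right] at h'
    push_cast
    linear_combination h'
  obtain ⟨⟨p, hp⟩, rfl⟩ : z ∈ LinearMap.range L.toLinearMap := htop ▸ Submodule.mem_top
  obtain ⟨a, ha1, ha2⟩ := T.closure.mem_graph_iff.1 hp
  exact ⟨a, by rw [ha1, ha2]; rfl⟩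

/-- The basic criterion for essential self-adjointness: for `y` in the domain of the adjoint of the
closure `S`, solve `S x + i x = S† y + i y`; then `y - x` lies in a deficiency space, so `y = x`. -/
theorem HasTrivialDeficiency.isEssentiallySelfAdjoint [CompleteSpace X] {T : X →ₗ.[ℂ] X}
    (hd : HasTrivialDeficiency T) (hsymm : IsSymmetricOp T) : IsEssentiallySelfAdjoint T := by
  obtain ⟨hdense, hT⟩ := hsymm
  have hc : T.IsClosable := LinearPMap.isClosable_iff_exists_closed_extension.2
    ⟨T.adjoint, LinearPMap.adjoint_isClosed hdense, hT.le_adjoint hdense⟩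
  refine ⟨hc, ?_⟩
  have hS := hT.closure hc
  have hSdense : Dense (T.closure.domain : Set X) := hdense.mono T.le_closure.1
  have hle := hS.le_adjoint hSdense
  rw [LinearPMap.isSelfAdjoint_def]
  refine (LinearPMap.eq_of_le_of_domain_eq hle (le_antisymm hle.1 fun y hy => ?_)).symm
  obtain ⟨x, hx⟩ := surjective_closure_add_I_smul hT hc hd
    (T.closure.adjoint ⟨y, hy⟩ + Complex.I • y)
  -- `y - x` lies in the kernel of `S† + i`, which is the deficiency space at `i`.
  have h0 : y - x = 0 := by
    refine hd _ 1 (by simp) fun u => ?_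
    have hu : (u : X) ∈ T.closure.domain := T.le_closure.1 u.2
    have hTu : T.closure ⟨u, hu⟩ = T u := (T.le_closure.2 rfl).symm
    have h1 := LinearPMap.adjoint_isFormalAdjoint hSdense ⟨y, hy⟩ ⟨u, hu⟩
    have h2 := hS x ⟨u, hu⟩
    have h3 : T.closure.adjoint ⟨y, hy⟩ - T.closure x = -(Complex.I • (y - x)) := by
      rw [smul_sub, neg_sub, sub_eq_sub_iff_add_eq_add, ← hx]
      abel
    rw [hTu] at h1 h2
    rw [inner_sub_left, ← h1, ← h2, ← inner_sub_left, h3]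
    simp [inner_neg_left, inner_smul_left, inner_sub_left]
  rw [sub_eq_zero.1 h0]
  exact x.2

/-! ### Vanishing of the deficiency spaces by the exponential series -/

theorem inner_iterate {T : X →ₗ.[ℂ] X} (hT : T.IsFormalAdjoint T) {w : ℕ → T.domain}
    (hw : ∀ n, (w (n + 1) : X) = T (w n)) (k l : ℕ) :
    inner ℂ (w k : X) (w l : X) = inner ℂ (w 0 : X) (w (k + l) : X) := by
  induction k generalizing l with
  | zero => rw [zero_add]
  | succ k ih => rw [hw, hT, ← hw, ih, add_right_comm, add_assoc]

theorem sum_antidiagonal_neg_pow_div_factorial (z : ℂ) (n : ℕ) :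
    ∑ p ∈ Finset.HasAntidiagonal.antidiagonal n,
      ((-z) ^ p.1 / (p.1.factorial : ℂ)) * (z ^ p.2 / (p.2.factorial : ℂ)) =
      if n = 0 then 1 else 0 := by
  have h : ∀ p ∈ Finset.HasAntidiagonal.antidiagonal n,
      ((-z) ^ p.1 / (p.1.factorial : ℂ)) * (z ^ p.2 / (p.2.factorial : ℂ)) =
        (n.choose p.1 • ((-z) ^ p.1 * z ^ p.2)) / (n.factorial : ℂ) := by
    intro p hp
    rw [Finset.HasAntidiagonal.mem_antidiagonal] at hp
    subst hp
    have h1 : ((p.1 + p.2).choose p.1 : ℂ) * p.1.factorial * p.2.factorial =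
        (p.1 + p.2).factorial := by
      rw [Nat.choose_symm_add]
      exact_mod_cast Nat.add_choose_mul_factorial_mul_factorial _ _
    have := p.1.factorial_ne_zero
    have := p.2.factorial_ne_zero
    have := (p.1 + p.2).factorial_ne_zero
    rw [nsmul_eq_mul]
    field_simp
    rw [← h1]
    ring
  rw [Finset.sum_congr rfl h, ← Finset.sum_div, ← (Commute.all (-z) z).add_pow', neg_add_cancel]
  rcases n with _ | n <;> simp

/-- The exponential series `∑ₙ (it)ⁿ / n! Tⁿ v` of a symmetric operator preserves the norm wherever
it converges absolutely: its squared norm is the sum over `N` of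
`(it - it)^N / N! ⟪v, T^N v⟫`. -/
theorem norm_tsum_exp {T : X →ₗ.[ℂ] X} [CompleteSpace X] (hT : T.IsFormalAdjoint T)
    {w : ℕ → T.domain} (hw : ∀ n, (w (n + 1) : X) = T (w n)) (t : ℝ)
    (hs : Summable fun n => ‖((Complex.I * t) ^ n / (n.factorial : ℂ)) • (w n : X)‖) :
    ‖∑' n, ((Complex.I * t) ^ n / (n.factorial : ℂ)) • (w n : X)‖ = ‖(w 0 : X)‖ := by
  set z : ℂ := Complex.I * t with hz
  have hzc : (starRingEnd ℂ) z = -z := by simp [hz]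
  set a : ℕ → X := fun n => (z ^ n / (n.factorial : ℂ)) • (w n : X) with ha
  have hsa : Summable a := hs.of_norm
  have hinner : ∀ p : ℕ × ℕ, inner ℂ (a p.1) (a p.2) =
      ((-z) ^ p.1 / (p.1.factorial : ℂ)) * (z ^ p.2 / (p.2.factorial : ℂ)) *
        inner ℂ (w 0 : X) (w (p.1 + p.2) : X) := by
    intro p
    simp only [ha, inner_smul_left, inner_smul_right, map_div₀, map_pow, hzc, map_natCast,
      ← inner_iterate hT hw p.1 p.2]
    ring
  have hsum : Summable fun p : ℕ × ℕ => inner ℂ (a p.1) (a p.2) :=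
    Summable.of_norm_bounded (hs.mul_of_nonneg hs (fun _ => norm_nonneg _) fun _ => norm_nonneg _)
      fun p => norm_inner_le_norm _ _
  have h1 : inner ℂ (∑' n, a n) (∑' n, a n) = ∑' p : ℕ × ℕ, inner ℂ (a p.1) (a p.2) := by
    rw [hsum.tsum_prod]
    have e1 := (innerSLFlip ℂ (∑' n, a n)).hasSum hsa.hasSum
    simp only [innerSLFlip_apply_apply] at e1
    rw [← e1.tsum_eq]
    refine tsum_congr fun k => ?_
    exact ((innerSL ℂ (a k)).hasSum hsa.hasSum).tsum_eq.symm
  have h2 : ∑' p : ℕ × ℕ, inner ℂ (a p.1) (a p.2) = inner ℂ (w 0 : X) (w 0 : X) := by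
    rw [← Finset.HasAntidiagonal.sigmaAntidiagonalEquivProd.tsum_eq]
    refine (Summable.tsum_sigma' (fun n => (hasSum_fintype _).summable)
        (Finset.HasAntidiagonal.sigmaAntidiagonalEquivProd.summable_iff.2 hsum)).trans ?_
    simp only [Function.comp_apply]
    have h3 : ∀ n, ∑' p : Finset.HasAntidiagonal.antidiagonal n,
        inner ℂ (a (Finset.HasAntidiagonal.sigmaAntidiagonalEquivProd ⟨n, p⟩).1)
          (a (Finset.HasAntidiagonal.sigmaAntidiagonalEquivProd ⟨n, p⟩).2) =
        (if n = 0 then 1 else 0) * inner ℂ (w 0 : X) (w n : X) := by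
      intro n
      rw [tsum_fintype, ← sum_antidiagonal_neg_pow_div_factorial z n, Finset.sum_mul,
        ← Finset.sum_coe_sort (Finset.HasAntidiagonal.antidiagonal n)]
      refine Finset.sum_congr rfl fun p _ => ?_
      simp only [Finset.HasAntidiagonal.sigmaAntidiagonalEquivProd_apply]
      rw [hinner, Finset.HasAntidiagonal.mem_antidiagonal.1 p.2]
    rw [tsum_congr h3, tsum_eq_single 0 fun n hn => by simp [hn]]
    simp
  have h4 : ‖∑' n, a n‖ ^ 2 = ‖(w 0 : X)‖ ^ 2 := by
    have h5 := h1.trans h2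
    rw [inner_self_eq_norm_sq_to_K, inner_self_eq_norm_sq_to_K] at h5
    exact_mod_cast h5
  exact (sq_eq_sq₀ (norm_nonneg _) (norm_nonneg _)).1 h4

/-- If the exponential series of a symmetric operator converges absolutely on its whole dense
domain for one common time `R > 0`, the deficiency spaces vanish. For `ψ` in the deficiency space
at `±i` the series `U v` satisfies `⟪ψ, U v⟫ = e^R ⟪ψ, v⟫` for a suitable sign of the time, whereas
`‖U v‖ = ‖v‖`; so `e^R ‖ψ‖ ≤ ‖ψ‖`. -/
theorem hasTrivialDeficiency_of_summable_exp [CompleteSpace X] {T : X →ₗ.[ℂ] X}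
    (hT : T.IsFormalAdjoint T) (hdense : Dense (T.domain : Set X)) {R : ℝ} (hR : 0 < R)
    (h : ∀ v ∈ T.domain, ∃ w : ℕ → T.domain, (w 0 : X) = v ∧ (∀ n, (w (n + 1) : X) = T (w n)) ∧
      Summable fun n : ℕ => R ^ n / n.factorial * ‖(w n : X)‖) :
    HasTrivialDeficiency T := by
  intro ψ s hs hψ
  have hs2 : s * s = 1 := by rw [← abs_mul_abs_self, hs, one_mul]
  have key : ∀ v ∈ T.domain, Real.exp R * ‖inner ℂ ψ v‖ ≤ ‖ψ‖ * ‖v‖ := by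
    intro v hv
    obtain ⟨w, rfl, hw, hsum⟩ := h v hv
    -- With this sign, `(it)(is) = R`, so the series below is that of `e^R`.
    set t : ℝ := -(s * R) with ht
    have hnorm : (fun n : ℕ => ‖((Complex.I * t) ^ n / (n.factorial : ℂ)) • (w n : X)‖) =
        fun n : ℕ => R ^ n / n.factorial * ‖(w n : X)‖ := by
      funext n
      simp only [norm_smul, norm_div, norm_pow, norm_mul, Complex.norm_I, one_mul, Complex.norm_real,
        Real.norm_eq_abs, ht, abs_neg, abs_mul, hs, abs_of_pos hR, Complex.norm_natCast]
    have hs' : Summable fun n : ℕ => ‖((Complex.I * t) ^ n / (n.factorial : ℂ)) • (w n : X)‖ := by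
      rwa [hnorm]
    have hmom : ∀ n, inner ℂ ψ (w n : X) = (Complex.I * s) ^ n * inner ℂ ψ (w 0 : X) := by
      intro n
      induction n with
      | zero => simp
      | succ n ih => rw [hw, hψ, ih, pow_succ]; ring
    have e1 := (innerSL ℂ ψ).hasSum hs'.of_norm.hasSum
    have e2 : HasSum (fun n : ℕ => ((R : ℂ) ^ n / (n.factorial : ℂ)) * inner ℂ ψ (w 0 : X))
        (Complex.exp R * inner ℂ ψ (w 0 : X)) := by
      have := NormedSpace.expSeries_div_hasSum_exp (𝔸 := ℂ) (R : ℂ)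
      rw [← Complex.exp_eq_exp_ℂ] at this
      exact this.mul_right _
    have e3 : inner ℂ ψ (∑' n : ℕ, ((Complex.I * t) ^ n / (n.factorial : ℂ)) • (w n : X)) =
        Complex.exp R * inner ℂ ψ (w 0 : X) := by
      refine e1.unique (e2.congr_fun fun n => ?_)
      rw [innerSL_apply_apply, inner_smul_right, hmom n]
      have : (Complex.I * t) * (Complex.I * s) = (R : ℂ) := by
        have hs3 : (s : ℂ) * s = 1 := by exact_mod_cast hs2
        rw [ht]
        push_cast
        linear_combination (-(s : ℂ) * s * R) * Complex.I_sq + (R : ℂ) * hs3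
      rw [← this, mul_pow]
      ring
    have e4 := norm_inner_le_norm (𝕜 := ℂ) ψ
      (∑' n : ℕ, ((Complex.I * t) ^ n / (n.factorial : ℂ)) • (w n : X))
    rwa [e3, norm_tsum_exp hT hw t hs', norm_mul, Complex.norm_exp, Complex.ofReal_re] at e4
  have hcl : IsClosed {v : X | Real.exp R * ‖inner ℂ ψ v‖ ≤ ‖ψ‖ * ‖v‖} :=
    isClosed_le (by fun_prop) (by fun_prop)
  have hall : Real.exp R * ‖inner ℂ ψ ψ‖ ≤ ‖ψ‖ * ‖ψ‖ :=
    closure_minimal (fun v hv => key v hv) hcl (hdense ψ)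
  rw [inner_self_eq_norm_sq_to_K, norm_pow] at hall
  have hexp : 1 < Real.exp R := Real.one_lt_exp_iff.2 hR
  by_contra h0
  have hpos : 0 < ‖ψ‖ * ‖ψ‖ := by
    have := norm_pos_iff.2 h0
    positivity
  simp only [RCLike.norm_ofReal, abs_norm] at hall
  nlinarith

end Operators

/-! ### The `ℓ¹`-norm of the number components -/

section Fock
open scoped TensorProduct DirectSum
variable {K : Type u} [NormedAddCommGroup K] [InnerProductSpace ℂ K]

local notation "ι₊" => DirectSum.lof ℂ ℕ (fun n => symPower _ n)

/-- The sum `∑_{m ≤ k} ‖ψ⁽ᵐ⁾‖` of the norms of the components with at most `k` particles. It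
dominates the norm on `atMost K k`, and operators can be estimated in it one component at a time. -/
noncomputable def levelNorm (k : ℕ) (ψ : Fock K) : ℝ := ∑ m ∈ Finset.range (k + 1), ‖ψ m‖

theorem levelNorm_nonneg (k : ℕ) (ψ : Fock K) : 0 ≤ levelNorm k ψ :=
  Finset.sum_nonneg fun _ _ => norm_nonneg _

theorem levelNorm_add_le (k : ℕ) (ψ φ : Fock K) :
    levelNorm k (ψ + φ) ≤ levelNorm k ψ + levelNorm k φ := by
  rw [levelNorm, levelNorm, levelNorm, ← Finset.sum_add_distrib]
  exact Finset.sum_le_sum fun m _ => norm_add_le _ _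

theorem levelNorm_sum_le {α : Type*} (k : ℕ) (s : Finset α) (ψ : α → Fock K) :
    levelNorm k (∑ i ∈ s, ψ i) ≤ ∑ i ∈ s, levelNorm k (ψ i) :=
  Finset.le_sum_of_subadditive _ (by simp [levelNorm]) (levelNorm_add_le k) _ _

theorem levelNorm_le (k : ℕ) (ψ : Fock K) : levelNorm k ψ ≤ (k + 1) * ‖ψ‖ := by
  refine (Finset.sum_le_card_nsmul _ _ ‖ψ‖ fun m _ =>
    lp.norm_apply_le_norm two_ne_zero ψ m).trans_eq ?_
  simp

theorem continuous_levelNorm (k : ℕ) : Continuous (levelNorm (K := K) k) :=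
  continuous_finsetSum _ fun m _ =>
    (lp.evalCLM ℂ (fun n => symPower K n) 2 m).continuous.norm

theorem isClosed_atMost (k : ℕ) : IsClosed (atMost K k : Set (Fock K)) := by
  have : (atMost K k : Set (Fock K)) =
      ⋂ m, ⋂ _ : k < m, {ψ : Fock K | lp.evalCLM ℂ (fun n => symPower K n) 2 m ψ = 0} := by
    ext ψ
    simp only [Set.mem_iInter]
    rfl
  rw [this]
  exact isClosed_iInter fun m => isClosed_iInter fun _ =>
    isClosed_eq (lp.evalCLM ℂ (fun n => symPower K n) 2 m).continuous continuous_const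

theorem toFock_lof_apply_ne {m i : ℕ} (h : i ≠ m) (z : symPower K m) :
    toFock K (ι₊ m z) i = 0 := by
  rw [toFock_apply]
  exact DirectSum.of_eq_of_ne _ _ _ h

theorem toFock_lof_mem_atMost {m k : ℕ} (h : m ≤ k) (z : symPower K m) :
    toFock K (ι₊ m z) ∈ atMost K k :=
  fun _ hi => toFock_lof_apply_ne (by omega) z

theorem levelNorm_toFock_lof_le (m k : ℕ) (z : symPower K m) :
    levelNorm k (toFock K (ι₊ m z)) ≤ ‖z‖ := by
  by_cases h : m ∈ Finset.range (k + 1)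
  · rw [levelNorm, Finset.sum_eq_single_of_mem m h fun i _ hi => by
      rw [toFock_lof_apply_ne hi, norm_zero]]
    rw [← norm_toFock_lof m z]
    exact lp.norm_apply_le_norm two_ne_zero _ m
  · refine (Finset.sum_eq_zero fun i hi => ?_).trans_le (norm_nonneg z)
    rw [toFock_lof_apply_ne (fun h' : i = m => h (h' ▸ hi)), norm_zero]

theorem atMost_mono {k l : ℕ} (h : k ≤ l) : atMost K k ≤ atMost K l :=
  fun _ hψ m hm => hψ m (by omega)

theorem levelNorm_of_mem_atMost {k l : ℕ} {ψ : Fock K} (hψ : ψ ∈ atMost K k) (h : k ≤ l) :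
    levelNorm l ψ = levelNorm k ψ := by
  refine (Finset.sum_subset (Finset.range_mono (by omega)) fun m _ hm => ?_).symm
  rw [hψ m (not_lt.1 fun h => hm (Finset.mem_range.2 h)), norm_zero]

theorem toFock_sum_lof {k : ℕ} {ψ : Fock K} (hψ : ψ ∈ atMost K k) :
    toFock K (∑ m ∈ Finset.range (k + 1), ι₊ m (ψ m)) = ψ := by
  ext1
  funext i
  rw [map_sum, lp.coeFn_sum, Finset.sum_apply]
  by_cases hi : i ∈ Finset.range (k + 1)
  · rw [Finset.sum_eq_single_of_mem i hi fun m _ hm => toFock_lof_apply_ne hm.symm _, toFock_apply]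
    exact DirectSum.of_eq_same _ _
  · rw [Finset.sum_eq_zero fun m hm =>
      toFock_lof_apply_ne (fun h : i = m => hi (h ▸ hm)) _]
    exact (hψ i (not_lt.1 fun h => hi (Finset.mem_range.2 h))).symm

theorem norm_le_levelNorm {k : ℕ} {ψ : Fock K} (hψ : ψ ∈ atMost K k) : ‖ψ‖ ≤ levelNorm k ψ := by
  conv_lhs => rw [← toFock_sum_lof hψ, map_sum]
  exact (norm_sum_le _ _).trans_eq (Finset.sum_congr rfl fun m _ => norm_toFock_lof _ _)

theorem mem_finiteParticle_iff_exists_atMost (ψ : Fock K) :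
    ψ ∈ finiteParticle K ↔ ∃ k, ψ ∈ atMost K k := by
  constructor
  · intro h
    obtain ⟨k, hk⟩ := ((mem_finiteParticle ψ).1 h).bddAbove
    refine ⟨k, fun m hm => ?_⟩
    by_contra h0
    exact absurd (hk h0) (by omega)
  · rintro ⟨k, hk⟩
    exact ⟨_, toFock_sum_lof hk⟩

/-! ### Number estimates for normal ordered polynomials -/

/-- `A` raises the particle number by at most two and is bounded by `C (n + 2)` on the `n`-particle
vectors. -/
def LevelBound (A : FinFock K →ₗ[ℂ] Fock K) (C : ℝ) : Prop :=
  ∀ n (y : symPower K n), A (ι₊ n y) ∈ atMost K (n + 2) ∧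
    levelNorm (n + 2) (A (ι₊ n y)) ≤ C * (n + 2) * ‖y‖

theorem LevelBound.add {A B : FinFock K →ₗ[ℂ] Fock K} {C D : ℝ} (hA : LevelBound A C)
    (hB : LevelBound B D) : LevelBound (A + B) (C + D) := fun n y =>
  ⟨Submodule.add_mem _ (hA n y).1 (hB n y).1, by
    refine (levelNorm_add_le _ _ _).trans ((add_le_add (hA n y).2 (hB n y).2).trans_eq ?_)
    ring⟩

theorem LevelBound.of_lof {A : FinFock K →ₗ[ℂ] Fock K} {C : ℝ}
    (h : ∀ n (y : symPower K n), ∃ m ≤ n + 2, ∃ z : symPower K m,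
      A (ι₊ n y) = toFock K (ι₊ m z) ∧ ‖z‖ ≤ C * (n + 2) * ‖y‖) : LevelBound A C := by
  intro n y
  obtain ⟨m, hm, z, hz, hle⟩ := h n y
  rw [hz]
  exact ⟨toFock_lof_mem_atMost hm z, (levelNorm_toFock_lof_le _ _ z).trans hle⟩

theorem levelBound_smul_toFock (c : ℂ) : LevelBound (c • toFock K) ‖c‖ :=
  LevelBound.of_lof fun n y => ⟨n, by omega, c • y, by simp, by
    rw [norm_smul]
    gcongr
    nlinarith [norm_nonneg c, n.cast_nonneg (α := ℝ)]⟩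

theorem sqrt_le_add_two (n : ℕ) : Real.sqrt (n + 1) ≤ n + 2 := by
  rw [Real.sqrt_le_left (by positivity)]
  nlinarith [n.cast_nonneg (α := ℝ)]

theorem levelBound_cre (f : K) : LevelBound (toFock K ∘ₗ cre K f) ‖f‖ :=
  LevelBound.of_lof fun n y => ⟨n + 1, by omega, creLevel K n f y, by
    rw [LinearMap.comp_apply, cre_lof], by
    refine (norm_creLevel_le n f y).trans ?_
    rw [mul_right_comm, mul_comm _ ‖f‖]
    gcongr
    exact sqrt_le_add_two n⟩

theorem levelBound_ann (g : Conj K) : LevelBound (toFock K ∘ₗ ann K g) ‖g‖ :=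
  LevelBound.of_lof fun
    | 0, y => ⟨0, by omega, 0, by rw [LinearMap.comp_apply, ann_lof_zero]; simp, by
        rw [norm_zero]; positivity⟩
    | n + 1, y => ⟨n, by omega, annLevel K n g y, by rw [LinearMap.comp_apply, ann_lof_succ], by
        refine (norm_annLevel_le n g y).trans ?_
        rw [mul_right_comm, mul_comm _ ‖g‖]
        gcongr
        refine (sqrt_le_add_two n).trans ?_
        push_cast
        linarith⟩

/-- A smeared product satisfies a number estimate if the unsmeared one does so, with a bound
proportional to the Hilbert tensor norm. -/
theorem levelBound_smear {E₁ E₂ : Type u} [NormedAddCommGroup E₁] [InnerProductSpace ℂ E₁]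
    [NormedAddCommGroup E₂] [InnerProductSpace ℂ E₂] {A : E₁ →ₗ[ℂ] Module.End ℂ (FinFock K)}
    {B : E₂ →ₗ[ℂ] Module.End ℂ (FinFock K)} (hs : Smearable A B)
    (h : ∀ n (y : symPower K n) (x : E₁ ⊗[ℂ] E₂), ∃ m ≤ n + 2, ∃ z : symPower K m,
      algSmear A B (ι₊ n y) x = toFock K (ι₊ m z) ∧ ‖z‖ ≤ (n + 2) * ‖y‖ * ‖x‖)
    (F : HTensor E₁ E₂) : LevelBound (smear A B hs F) ‖F‖ := by
  intro n y
  have hcont := continuous_smear A B hs (ι₊ n y)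
  induction F using UniformSpace.Completion.induction_on with
  | hp =>
    refine ((isClosed_atMost _).preimage hcont).inter
      (isClosed_le ((continuous_levelNorm _).comp hcont) (by fun_prop))
  | ih x =>
    obtain ⟨m, hm, z, hz, hle⟩ := h n y x
    have he : smear A B hs (x : HTensor E₁ E₂) (ι₊ n y) = toFock K (ι₊ m z) :=
      (hs.extend_coe _ x).trans hz
    rw [he, UniformSpace.Completion.norm_coe]
    exact ⟨toFock_lof_mem_atMost hm z, (levelNorm_toFock_lof_le _ _ z).trans
      (hle.trans_eq (by ring))⟩

theorem exists_algSmear_cre {E : Type u} [NormedAddCommGroup E] [InnerProductSpace ℂ E]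
    {B : E →ₗ[ℂ] Module.End ℂ (FinFock K)} {n m : ℕ} {y : symPower K n} (b : E →L[ℂ] symPower K m)
    (hb : ∀ e, B e (ι₊ n y) = ι₊ m (b e)) (x : K ⊗[ℂ] E) :
    ∃ z : symPower K (m + 1), algSmear (cre K) B (ι₊ n y) x = toFock K (ι₊ (m + 1) z) ∧
      ‖z‖ ≤ Real.sqrt (m + 1) * ‖b‖ * ‖x‖ := by
  obtain ⟨T, hT, hT'⟩ := exists_creLift m b
  refine ⟨T x, ?_, hT' x⟩
  have : algSmear (cre K) B (ι₊ n y) = toFock K ∘ₗ ι₊ (m + 1) ∘ₗ T.toLinearMap :=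
    TensorProduct.ext' fun x e => by
      rw [algSmear_tmul, hb, cre_lof, ← hT]; rfl
  rw [this]
  rfl

theorem levelBound_cre_cre (F : HTensor K K) :
    LevelBound (smear (cre K) (cre K) smearable_cre_cre F) ‖F‖ := by
  refine levelBound_smear _ (fun n y x => ?_) F
  let b : K →L[ℂ] symPower K (n + 1) :=
    (LinearMap.applyₗ y ∘ₗ ContinuousLinearMap.coeLM ℂ ∘ₗ creLevel K n).mkContinuous
      (Real.sqrt (n + 1) * ‖y‖) fun e => norm_creLevel_le n e y
  have hbn : ‖b‖ ≤ Real.sqrt (n + 1) * ‖y‖ := LinearMap.mkContinuous_norm_le _ (by positivity) _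
  obtain ⟨z, hz, hle⟩ := exists_algSmear_cre b (fun e => cre_lof e n y) x
  refine ⟨n + 2, le_rfl, z, hz, hle.trans (mul_le_mul_of_nonneg_right ?_ (norm_nonneg x))⟩
  have hcast : ((n + 1 : ℕ) : ℝ) + 1 = n + 2 := by push_cast; ring
  have hsqrt : Real.sqrt (n + 1) ≤ Real.sqrt (n + 2) := Real.sqrt_le_sqrt (by linarith)
  rw [hcast]
  calc Real.sqrt (n + 2) * ‖b‖
      ≤ Real.sqrt (n + 2) * (Real.sqrt (n + 2) * ‖y‖) := by
        exact mul_le_mul_of_nonneg_left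
          (hbn.trans (mul_le_mul_of_nonneg_right hsqrt (norm_nonneg y))) (Real.sqrt_nonneg _)
    _ = (n + 2) * ‖y‖ := by rw [← mul_assoc, Real.mul_self_sqrt (by positivity)]

theorem levelBound_cre_ann (G : HTensor K (Conj K)) :
    LevelBound (smear (cre K) (ann K) smearable_cre_ann G) ‖G‖ := by
  refine levelBound_smear _ (fun n y x => ?_) G
  rcases n with _ | n
  · obtain ⟨z, hz, hle⟩ := exists_algSmear_cre (B := ann K) (0 : Conj K →L[ℂ] symPower K 0)
      (fun e => (ann_lof_zero e y).trans (by simp)) x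
    exact ⟨1, by omega, z, hz, hle.trans (by
      rw [ContinuousLinearMap.opNorm_zero, mul_zero, zero_mul]
      positivity)⟩
  let b : Conj K →L[ℂ] symPower K n :=
    (LinearMap.applyₗ y ∘ₗ ContinuousLinearMap.coeLM ℂ ∘ₗ annLevel K n).mkContinuous
      (Real.sqrt (n + 1) * ‖y‖) fun e => norm_annLevel_le n e y
  have hbn : ‖b‖ ≤ Real.sqrt (n + 1) * ‖y‖ := LinearMap.mkContinuous_norm_le _ (by positivity) _
  obtain ⟨z, hz, hle⟩ := exists_algSmear_cre b (fun e => ann_lof_succ e n y) x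
  refine ⟨n + 1, by omega, z, hz, hle.trans (mul_le_mul_of_nonneg_right ?_ (norm_nonneg x))⟩
  calc Real.sqrt (n + 1) * ‖b‖
      ≤ Real.sqrt (n + 1) * (Real.sqrt (n + 1) * ‖y‖) := by gcongr
    _ = (n + 1) * ‖y‖ := by rw [← mul_assoc, Real.mul_self_sqrt (by positivity)]
    _ ≤ ((n + 1 : ℕ) + 2) * ‖y‖ := by
        refine mul_le_mul_of_nonneg_right ?_ (norm_nonneg y)
        push_cast
        linarith

/-- The map `j f ⊗ j h ↦ a₊(f) a₊(h) y` is, up to the antilinear isometry `j f ⊗ j h ↦ h ⊗ f`, the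
adjoint of the two-fold creation map, which gives its bound in the Hilbert tensor norm. -/
theorem exists_algSmear_ann_ann (n : ℕ) (y : symPower K (n + 2)) (x : Conj K ⊗[ℂ] Conj K) :
    ∃ z : symPower K n, algSmear (ann K) (ann K) (ι₊ (n + 2) y) x = toFock K (ι₊ n z) ∧
      ‖z‖ ≤ Real.sqrt (n + 2) * Real.sqrt (n + 1) * ‖y‖ * ‖x‖ := by
  let g : Conj K ⊗[ℂ] Conj K →ₗ[ℂ] symPower K n :=
    TensorProduct.lift (LinearMap.mk₂ ℂ (fun f h => annLevel K n f (annLevel K (n + 1) h y))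
      (by simp) (by simp) (by simp) (by simp))
  have hg : algSmear (ann K) (ann K) (ι₊ (n + 2) y) = toFock K ∘ₗ ι₊ n ∘ₗ g :=
    TensorProduct.ext' fun f h => by
      rw [algSmear_tmul, ann_lof_succ, ann_lof_succ]; rfl
  refine ⟨g x, by rw [hg]; rfl, ?_⟩
  obtain ⟨J, hJ, hJn⟩ := exists_conjSwap (K := K)
  let b : K →L[ℂ] symPower K (n + 1) :=
    (LinearMap.applyₗ (g x) ∘ₗ ContinuousLinearMap.coeLM ℂ ∘ₗ creLevel K n).mkContinuous
      (Real.sqrt (n + 1) * ‖g x‖) fun e => norm_creLevel_le n e (g x)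
  have hbn : ‖b‖ ≤ Real.sqrt (n + 1) * ‖g x‖ := LinearMap.mkContinuous_norm_le _ (by positivity) _
  obtain ⟨T, hT, hTn⟩ := exists_creLift (n + 1) b
  have key : ∀ w, inner ℂ (g x) (g w) = inner ℂ (T (J w)) y := fun w => by
    induction w using TensorProduct.induction_on with
    | zero => simp
    | tmul f h =>
      rw [hJ, hT]
      exact (annLevel_adjoint n f _ _).trans (annLevel_adjoint (n + 1) h _ _)
    | add a b ha hb => rw [map_add, map_add, map_add, inner_add_right, inner_add_left, ha, hb]
  rcases (norm_nonneg (g x)).eq_or_lt with h | h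
  · rw [← h]; positivity
  refine le_of_mul_le_mul_right ?_ h
  have h1 : ‖g x‖ * ‖g x‖ = ‖inner ℂ (g x) (g x)‖ := by
    rw [inner_self_eq_norm_sq_to_K, norm_pow]; simp [sq]
  have hcast : ((n + 1 : ℕ) : ℝ) + 1 = n + 2 := by push_cast; ring
  rw [h1, key x]
  calc ‖inner ℂ (T (J x)) y‖ ≤ ‖T (J x)‖ * ‖y‖ := norm_inner_le_norm _ _
    _ ≤ (Real.sqrt (n + 2) * (Real.sqrt (n + 1) * ‖g x‖) * ‖x‖) * ‖y‖ := by
        gcongr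
        refine (hTn (J x)).trans ?_
        rw [hcast, hJn]
        gcongr
    _ = Real.sqrt (n + 2) * Real.sqrt (n + 1) * ‖y‖ * ‖x‖ * ‖g x‖ := by ring

theorem levelBound_ann_ann (H : HTensor (Conj K) (Conj K)) :
    LevelBound (smear (ann K) (ann K) smearable_ann_ann H) ‖H‖ := by
  refine levelBound_smear _ (fun n y x => ?_) H
  have hz : (∀ f h : Conj K, ann K f (ann K h (ι₊ n y)) = 0) →
      ∃ m ≤ n + 2, ∃ z : symPower K m,
        algSmear (ann K) (ann K) (ι₊ n y) x = toFock K (ι₊ m z) ∧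
          ‖z‖ ≤ (n + 2) * ‖y‖ * ‖x‖ := fun h => by
    have : algSmear (ann K) (ann K) (ι₊ n y) = 0 :=
      TensorProduct.ext' fun f e => by rw [algSmear_tmul, h]; simp
    exact ⟨0, by omega, 0, by simp [this], by rw [norm_zero]; positivity⟩
  match n, y, hz with
  | 0, y, hz => exact hz fun f h => by rw [ann_lof_zero, map_zero]
  | 1, y, hz => exact hz fun f h => by rw [ann_lof_succ, ann_lof_zero]
  | n + 2, y, _ =>
    obtain ⟨z, hz, hle⟩ := exists_algSmear_ann_ann n y x
    refine ⟨n, by omega, z, hz, hle.trans ?_⟩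
    gcongr
    calc Real.sqrt (n + 2) * Real.sqrt (n + 1)
        ≤ Real.sqrt (n + 2) * Real.sqrt (n + 2) := by gcongr; norm_num
      _ = n + 2 := Real.mul_self_sqrt (by positivity)
      _ ≤ ((n + 2 : ℕ) : ℝ) + 2 := by push_cast; linarith

theorem exists_levelBound_wickPolynomial (c : ℂ) (f : K) (g : Conj K) (F : HTensor K K)
    (G : HTensor K (Conj K)) (H : HTensor (Conj K) (Conj K)) :
    ∃ C, 0 < C ∧ LevelBound (wickPolynomial K c f g F G H) C := by
  have h := ((((levelBound_smul_toFock (K := K) c).add (levelBound_cre f)).add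
    (levelBound_ann g)).add (levelBound_cre_cre F)).add (levelBound_cre_ann G) |>.add
    (levelBound_ann_ann H)
  -- The summand `1` keeps the constant positive when all coefficients vanish.
  refine ⟨‖c‖ + ‖f‖ + ‖g‖ + ‖F‖ + ‖G‖ + ‖H‖ + 1, by positivity,
    fun n y => ⟨(h n y).1, (h n y).2.trans ?_⟩⟩
  refine mul_le_mul_of_nonneg_right (mul_le_mul_of_nonneg_right ?_ ?_) (norm_nonneg y)
  · linarith
  · positivity

/-- With the number estimate, the normal ordered polynomial maps `atMost K k` to `atMost K (k + 2)`, with norm at most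
`C (k + 2)` with respect to `levelNorm`. -/
theorem wickOperator_levelNorm_le {c : ℂ} {f : K} {g : Conj K} {F : HTensor K K}
    {G : HTensor K (Conj K)} {H : HTensor (Conj K) (Conj K)} {C : ℝ} (hC : 0 ≤ C)
    (h : LevelBound (wickPolynomial K c f g F G H) C) (k : ℕ)
    (ψ : (wickOperator K c f g F G H).domain) (hψ : (ψ : Fock K) ∈ atMost K k) :
    wickOperator K c f g F G H ψ ∈ atMost K (k + 2) ∧
      levelNorm (k + 2) (wickOperator K c f g F G H ψ) ≤ C * (k + 2) * levelNorm k (ψ : Fock K) := by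
  have he : wickOperator K c f g F G H ψ =
      ∑ m ∈ Finset.range (k + 1), wickPolynomial K c f g F G H (ι₊ m ((ψ : Fock K) m)) := by
    rw [← map_sum, ← wickOperator_apply]
    congr 1
    exact Subtype.ext (toFock_sum_lof hψ).symm
  have hle : ∀ m ∈ Finset.range (k + 1), m + 2 ≤ k + 2 := fun m hm => by
    have := Finset.mem_range.1 hm
    omega
  rw [he]
  refine ⟨Submodule.sum_mem _ fun m hm => atMost_mono (hle m hm) (h m _).1, ?_⟩
  refine (levelNorm_sum_le _ _ _).trans ?_
  rw [levelNorm, Finset.mul_sum]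
  refine Finset.sum_le_sum fun m hm => ?_
  rw [levelNorm_of_mem_atMost (h m _).1 (hle m hm)]
  refine (h m _).2.trans ?_
  have : (m : ℝ) + 2 ≤ k + 2 := by exact_mod_cast hle m hm
  gcongr

/-! ### Iterates of an operator raising the particle number by two -/

/-- The growth `C (k + 2j + 2)` of the `j`-th step is linear in `j`, so for every `k` the ratio of
consecutive terms of the exponential series at the time `1 / (4 C)` is at most `3 / 4` for `j ≥ k`. -/
theorem summable_of_le_linear_growth {C : ℝ} (hC : 0 < C) (k : ℕ) {a : ℕ → ℝ} (ha : ∀ n, 0 ≤ a n)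
    (h : ∀ n, a (n + 1) ≤ C * ((k + 2 * n : ℕ) + 2) * a n) :
    Summable fun n : ℕ => (4 * C)⁻¹ ^ n / n.factorial * a n := by
  have hpos : ∀ n : ℕ, 0 ≤ (4 * C)⁻¹ ^ n / n.factorial * a n := fun n =>
    mul_nonneg (by positivity) (ha n)
  refine summable_of_ratio_norm_eventually_le (r := 3 / 4) (by norm_num)
    ((eventually_ge_atTop k).mono fun n hn => ?_)
  rw [Real.norm_of_nonneg (hpos _), Real.norm_of_nonneg (hpos _)]
  have h1 : ((2 * n + (k + 2 : ℕ) : ℝ)) / (4 * n + (4 : ℕ)) ≤ 3 / 4 := by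
    have hkn : (k : ℝ) ≤ n := by exact_mod_cast hn
    rw [div_le_div_iff₀ (by positivity) (by norm_num)]
    push_cast
    linarith
  calc (4 * C)⁻¹ ^ (n + 1) / (n + 1).factorial * a (n + 1)
      ≤ (4 * C)⁻¹ ^ (n + 1) / (n + 1).factorial * (C * ((k + 2 * n : ℕ) + 2) * a n) := by
        gcongr
        exact h n
    _ = ((2 * n + (k + 2 : ℕ) : ℝ)) / (4 * n + (4 : ℕ)) *
          ((4 * C)⁻¹ ^ n / n.factorial * a n) := by
        rw [Nat.factorial_succ]
        have := n.factorial_ne_zero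
        push_cast
        have h4 : (4 * n + 4 : ℝ) = 4 * (n + 1) := by ring
        rw [h4, pow_succ]
        field_simp
        ring
    _ ≤ 3 / 4 * ((4 * C)⁻¹ ^ n / n.factorial * a n) := by
        exact mul_le_mul_of_nonneg_right h1 (hpos n)

section Analytic
variable {X : Type u} [NormedAddCommGroup X] [InnerProductSpace ℂ X]

theorem isAnalyticVector_of_summable_exp {T : X →ₗ.[ℂ] X} {R : ℝ} (hR : 0 < R) {w : ℕ → T.domain}
    (hw : ∀ n, (w (n + 1) : X) = T (w n))
    (hs : Summable fun n : ℕ => R ^ n / n.factorial * ‖(w n : X)‖) :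
    IsAnalyticVector T (w 0 : X) := by
  set M := ∑' n : ℕ, R ^ n / n.factorial * ‖(w n : X)‖
  have hle : ∀ n : ℕ, R ^ n / n.factorial * ‖(w n : X)‖ ≤ M := fun n =>
    hs.le_tsum n fun j _ => by positivity
  have hM : 0 ≤ M := tsum_nonneg fun j => by positivity
  have hc : 0 < M + R⁻¹ := by positivity
  refine ⟨M + R⁻¹, hc, w, rfl, hw, fun n => ?_⟩
  have hn := hle n
  rw [div_mul_eq_mul_div, div_le_iff₀ (by positivity), ← le_div_iff₀' (by positivity)] at hn
  calc ‖(w n : X)‖ ≤ M * n.factorial / R ^ n := hn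
    _ = R⁻¹ ^ n * M * n.factorial := by rw [inv_pow]; ring
    _ ≤ (M + R⁻¹) ^ n * (M + R⁻¹) * n.factorial := by
        have : 0 < R⁻¹ := inv_pos.2 hR
        gcongr <;> linarith
    _ = _ := by rw [pow_succ]

end Analytic

section WickOperator
variable {c : ℂ} {f : K} {g : Conj K} {F : HTensor K K} {G : HTensor K (Conj K)}
  {H : HTensor (Conj K) (Conj K)}

theorem preservesDomain_wickOperator : PreservesDomain (wickOperator K c f g F G H) := by
  obtain ⟨C, hC, hb⟩ := exists_levelBound_wickPolynomial c f g F G H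
  intro ψ
  obtain ⟨k, hk⟩ := (mem_finiteParticle_iff_exists_atMost _).1 ψ.2
  exact (mem_finiteParticle_iff_exists_atMost _).2
    ⟨_, (wickOperator_levelNorm_le hC.le hb k ψ hk).1⟩

/-- The exponential series of a restriction of the normal ordered polynomial to an invariant domain
converges absolutely for a time which is the same for all vectors. -/
theorem exists_summable_exp_of_le_wickOperator :
    ∃ R : ℝ, 0 < R ∧ ∀ T : Fock K →ₗ.[ℂ] Fock K, T ≤ wickOperator K c f g F G H →
      PreservesDomain T → ∀ v ∈ T.domain, ∃ w : ℕ → T.domain, (w 0 : Fock K) = v ∧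
        (∀ n, (w (n + 1) : Fock K) = T (w n)) ∧
        Summable fun n : ℕ => R ^ n / n.factorial * ‖(w n : Fock K)‖ := by
  obtain ⟨C, hC, hb⟩ := exists_levelBound_wickPolynomial c f g F G H
  refine ⟨(4 * C)⁻¹, by positivity, fun T hT hp v hv => ?_⟩
  let w : ℕ → T.domain := fun n => (fun x : T.domain => (⟨T x, hp x⟩ : T.domain))^[n] ⟨v, hv⟩
  have hw : ∀ n, (w (n + 1) : Fock K) = T (w n) := fun n => by
    simp only [w, Function.iterate_succ_apply']
  refine ⟨w, rfl, hw, ?_⟩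
  obtain ⟨k, hk⟩ := (mem_finiteParticle_iff_exists_atMost v).1 (hT.1 hv)
  have hstep : ∀ n, (w n : Fock K) ∈ atMost K (k + 2 * n) →
      (w (n + 1) : Fock K) ∈ atMost K (k + 2 * (n + 1)) ∧
      levelNorm (k + 2 * (n + 1)) (w (n + 1) : Fock K) ≤
        C * ((k + 2 * n : ℕ) + 2) * levelNorm (k + 2 * n) (w n : Fock K) := fun n hn => by
    have he : T (w n) = wickOperator K c f g F G H ⟨w n, hT.1 (w n).2⟩ := hT.2 rfl
    rw [hw, he]
    exact wickOperator_levelNorm_le hC.le hb (k + 2 * n) ⟨w n, hT.1 (w n).2⟩ hn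
  have hmem : ∀ n, (w n : Fock K) ∈ atMost K (k + 2 * n) := fun n => by
    induction n with
    | zero => exact hk
    | succ n ih => exact (hstep n ih).1
  refine Summable.of_nonneg_of_le (fun n => by positivity) (fun n => ?_)
    (summable_of_le_linear_growth hC k (a := fun n => levelNorm (k + 2 * n) (w n : Fock K))
      (fun n => levelNorm_nonneg _ _) fun n => (hstep n (hmem n)).2)
  exact mul_le_mul_of_nonneg_left (norm_le_levelNorm (hmem n)) (by positivity)

theorem isAnalyticVector_of_le_wickOperator {T : Fock K →ₗ.[ℂ] Fock K}
    (hT : T ≤ wickOperator K c f g F G H) (hp : PreservesDomain T) (v : Fock K)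
    (hv : v ∈ T.domain) : IsAnalyticVector T v := by
  obtain ⟨R, hR, h⟩ := exists_summable_exp_of_le_wickOperator (c := c) (f := f) (g := g) (F := F)
    (G := G) (H := H)
  obtain ⟨w, rfl, hw, hs⟩ := h T hT hp v hv
  exact isAnalyticVector_of_summable_exp hR hw hs

/-! ### Domains that are dense in the spaces of bounded particle number -/

theorem exists_norm_wickOperator_le (c : ℂ) (f : K) (g : Conj K) (F : HTensor K K)
    (G : HTensor K (Conj K)) (H : HTensor (Conj K) (Conj K)) (k : ℕ) :
    ∃ D, ∀ ψ : (wickOperator K c f g F G H).domain, (ψ : Fock K) ∈ atMost K k →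
      ‖wickOperator K c f g F G H ψ‖ ≤ D * ‖(ψ : Fock K)‖ := by
  obtain ⟨C, hC, hb⟩ := exists_levelBound_wickPolynomial c f g F G H
  refine ⟨C * (k + 2) * (k + 1), fun ψ hψ => ?_⟩
  obtain ⟨h1, h2⟩ := wickOperator_levelNorm_le hC.le hb k ψ hψ
  refine (norm_le_levelNorm h1).trans (h2.trans ?_)
  rw [mul_assoc _ (k + 1 : ℝ)]
  exact mul_le_mul_of_nonneg_left (levelNorm_le _ _) (by positivity)

/-- If the domain of `T` is dense in each `atMost K k`, the graph of the normal ordered polynomial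
lies in the closure of the graph of its restriction `T`, because the polynomial is bounded on
`atMost K k`. -/
theorem graph_wickOperator_subset_closure {T : Fock K →ₗ.[ℂ] Fock K}
    (hT : T ≤ wickOperator K c f g F G H)
    (hd : ∀ n, (atMost K n : Set (Fock K)) ⊆
      closure (T.domain ⊓ atMost K n : Submodule ℂ (Fock K)))
    (ψ : (wickOperator K c f g F G H).domain) :
    ((ψ : Fock K), wickOperator K c f g F G H ψ) ∈ closure (T.graph : Set (Fock K × Fock K)) := by
  obtain ⟨k, hk⟩ := (mem_finiteParticle_iff_exists_atMost _).1 ψ.2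
  obtain ⟨D, hD⟩ := exists_norm_wickOperator_le c f g F G H k
  obtain ⟨x, hx, hlim⟩ := mem_closure_iff_seq_limit.1 (hd k hk)
  let y : ℕ → (wickOperator K c f g F G H).domain := fun n => ⟨x n, hT.1 (hx n).1⟩
  have hy : Tendsto (fun n => wickOperator K c f g F G H (y n)) atTop
      (𝓝 (wickOperator K c f g F G H ψ)) := by
    rw [tendsto_iff_norm_sub_tendsto_zero]
    have h0 := (tendsto_iff_norm_sub_tendsto_zero.1 hlim).const_mul D
    rw [mul_zero] at h0
    refine squeeze_zero (fun _ => norm_nonneg _) (fun n => ?_) h0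
    rw [← LinearPMap.map_sub]
    exact hD (y n - ψ) (Submodule.sub_mem _ (hx n).2 hk)
  refine mem_closure_of_tendsto (hlim.prodMk_nhds hy) (Eventually.of_forall fun n => ?_)
  exact T.mem_graph_iff.2 ⟨⟨x n, (hx n).1⟩, rfl, hT.2 rfl⟩

end WickOperator
end Fock

end BosonFock

theorem mainTheorem9 {K : Type*} [NormedAddCommGroup K] [InnerProductSpace ℂ K] [CompleteSpace K]
    (c : ℂ) (f : K) (g : Conj K)
    (F : HTensor K K) (G : HTensor K (Conj K)) (H : HTensor (Conj K) (Conj K)) :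
    -- on the space of all finite particle vectors
    PreservesDomain (wickOperator K c f g F G H) ∧
    (∀ v ∈ finiteParticle K, IsAnalyticVector (wickOperator K c f g F G H) v) ∧
    -- restrictions `T` to dense subspaces of finite particle vectors
    ∀ T : Fock K →ₗ.[ℂ] Fock K, T ≤ wickOperator K c f g F G H → Dense (T.domain : Set (Fock K)) →
      (PreservesDomain T → ∀ v ∈ T.domain, IsAnalyticVector T v) ∧
      (IsSymmetricOp T →
        (PreservesDomain T ∨
          ∀ n, (atMost K n : Set (Fock K)) ⊆ closure (T.domain ⊓ atMost K n : Submodule ℂ (Fock K))) →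
        IsEssentiallySelfAdjoint T) := by
  obtain ⟨R, hR, hsum⟩ := exists_summable_exp_of_le_wickOperator (c := c) (f := f) (g := g) (F := F)
    (G := G) (H := H)
  refine ⟨preservesDomain_wickOperator,
    isAnalyticVector_of_le_wickOperator le_rfl preservesDomain_wickOperator, fun T hT hdense =>
    ⟨isAnalyticVector_of_le_wickOperator hT, fun hsymm h => ?_⟩⟩
  refine HasTrivialDeficiency.isEssentiallySelfAdjoint ?_ hsymm
  rcases h with hp | hd
  · exact hasTrivialDeficiency_of_summable_exp hsymm.2 hdense hR (hsum T hT hp)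
  -- Symmetry passes from `T` to the whole polynomial, and trivial deficiency back to `T`.
  · have hgraph := graph_wickOperator_subset_closure hT hd
    exact (hasTrivialDeficiency_of_summable_exp
      (isFormalAdjoint_of_graph_subset_closure hsymm.2 hgraph) (hdense.mono hT.1) hR
      (hsum _ le_rfl preservesDomain_wickOperator)).of_graph_subset_closure hgraph
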